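/- Let $\mathbf{k}$ be a nonzero commutative ring with $1$, let $X$ be a set, $\Omega$ a nonempty set, and $\lambda_\Omega=(\lambda_\omega)_{\omega\in\Omega}$ a family of elements of $\mathbf{k}$. Algebras are associative and unital. A matching Rota-Baxter algebra of weight $\lambda_\Omega$ is a $\mathbf{k}$-algebra $R$ with linear operators $P_\omega:R\to R$ ($\omega\in\Omega$) such that $P_\alpha(x)P_\beta(y)=P_\alpha(xP_\beta(y))+P_\beta(P_\alpha(x)y)+\lambda_\beta P_\alpha(xy)$ for all $x,y\in R$ and $\alpha,\beta\in\Omega$; homomorphisms are algebra homomorphisms that commute with the operators. Let $\mathfrak{M}=\mathfrak{M}(X,\Omega)$ be the monoid of $\Omega$-bracketed words in $X$, that is, the free monoid on letters $x\in X$ and $\lfloor w\rfloor_\omega$ with $w\in\mathfrak{M}$, $\omega\in\Omega$ (built recursively), and let $P_\omega$ be the linear operator on $\mathbf{k}\mathfrak{M}$ with $P_\omega(w)=\lfloor w\rfloor_\omega$. Let $$S=\{\lfloor x\rfloor_\alpha\lfloor y\rfloor_\beta-\lfloor x\lfloor y\rfloor_\beta\rfloor_\alpha-\lfloor\lfloor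 x\rfloor_\alpha y\rfloor_\beta-\lambda_\beta\lfloor xy\rfloor_\alpha \mid x,y\in\mathfrak{M},\ \alpha,\beta\in\Omega\},$$ and let $\mathrm{Id}(S)$ be the smallest two-sided ideal of $\mathbf{k}\mathfrak{M}$ that contains $S$ and is stable under all $P_\omega$. Let $M(X)\subseteq\mathfrak{M}$ be the free monoid on $X$ and $S(X)=M(X)\setminus\{1\}$. For $Z\subseteq\mathfrak{M}$ put $\lfloor Z\rfloor_\Omega=\{\lfloor z\rfloor_\omega\mid z\in Z,\omega\in\Omega\}$, and for $Y,Z\subseteq\mathfrak{M}$ put $$\Lambda(Y,Z)=\bigcup_{r\ge1}(Y\lfloor Z\rfloor_\Omega)^r\cup\bigcup_{r\ge0}(Y\lfloor Z\rfloor_\Omega)^rY\cup\bigcup_{r\ge1}(\lfloor Z\rfloor_\Omega Y)^r\cup\bigcup_{r\ge0}(\lfloor Z\rfloor_\Omega Y)^r\lfloor Z\rfloor_\Omega\cup\{1\}.$$ Let $\mathfrak{X}_0=M(X)$, $\mathfrak{X}_n=\Lambda(S(X),\mathfrak{X}_{n-1})$ for $n\ge1$, and $\mathfrak{X}_\infty=\bigcup_n\mathfrak{X}_n$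 (the matching Rota-Baxter words). Given well orders on $X$ and $\Omega$, write $u\in\mathfrak{M}$ uniquely as $u=u_0\lfloor u_1^*\rfloor_{\alpha_1}u_1\cdots\lfloor u_r^*\rfloor_{\alpha_r}u_r$ with $u_i\in M(X)$, and define $\le_{\mathrm{db}}$ on $\mathfrak{M}$ by comparing first the total number of brackets, then $r$, and then lexicographically $(\alpha_1,u_1^*,\dots,\alpha_r,u_r^*,u_0,\dots,u_r)$, where the $u_i^*$ are compared recursively and the $u_i$ by the degree lexicographical order. For $s\in S$ let $\bar s$ be its largest word. Let $\mathrm{Irr}(S)$ be the set of words in $\mathfrak{M}$ that are not of the form $q|_{\bar s}$, where $s\in S$, $q$ is a bracketed word on $X\sqcup\{\star\}$ with exactly one occurrence of $\star$, and $q|_u$ denotes the result of replacing $\star$ in $q$ by $u$. For $w=w_1\cdots w_m$ and $w'=w'_1\cdots w'_{m'}$ in $\mathfrak{X}_\infty$, written as products of letters of $\mathfrak{M}$, define $w\diamond w'$ recursively: if $m,m'\ge1$, $w_m=\lfloor u\rfloor_\alpha$ and $w'_1=\lfloor v\rfloor_\beta$, then $$w\diamond w'=w_1\cdots w_{m-1}\bigl(P_\alpha(u\diamond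 w'_1)+P_\beta(w_m\diamond v)+\lambda_\beta P_\alpha(u\diamond v)\bigr)w'_2\cdots w'_{m'};$$ in all other cases $w\diamond w'=ww'$ is the concatenation. Then: 1. $\mathrm{Irr}(S)=\mathfrak{X}_\infty$ for every choice of well orders on $X$ and $\Omega$, and $\mathfrak{X}_\infty$ is the set of bracketed words in which no two bracketed factors $\lfloor u\rfloor_\alpha\lfloor v\rfloor_\beta$ are adjacent, at any level of nesting. 2. $\mathbf{k}\mathfrak{M}/\mathrm{Id}(S)$, with the induced operators and the map $x\mapsto x+\mathrm{Id}(S)$ from $X$, is a free matching Rota-Baxter algebra of weight $\lambda_\Omega$ on $X$: it is a matching Rota-Baxter algebra of weight $\lambda_\Omega$, and every map from $X$ to such an algebra $R$ extends uniquely to a homomorphism to $R$. 3. $\mathfrak{X}_\infty$ modulo $\mathrm{Id}(S)$ is a $\mathbf{k}$-linear basis of $\mathbf{k}\mathfrak{M}/\mathrm{Id}(S)$. 4. In terms of this basis the operator $P_\omega$ sends $w$ to $\lfloor w\rfloor_\omega\in\mathfrak{X}_\infty$, and the product of $w,w'\in\mathfrak{X}_\infty$ is $w\diamond w'$, which lies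 in $\mathbf{k}\mathfrak{X}_\infty$. -/

import Mathlib

open scoped Pointwise

namespace MatchingRB

/-! ### Matching Rota-Baxter algebras -/

/-- The operators `P ω` on the `k`-algebra `R` satisfy the matching Rota-Baxter equation of
weight `lam`. -/
def IsMatchingRB {k Ω R : Type*} [CommRing k] [Ring R] [Algebra k R] (lam : Ω → k)
    (P : Ω → R →ₗ[k] R) : Prop :=
  ∀ (α β : Ω) (x y : R),
    P α x * P β y = P α (x * P β y) + P β (P α x * y) + lam β • P α (x * y)

/-! ### Operated ideals and the quotient by one -/

section Operated

variable {k Ω A : Type*} [CommRing k] [Ring A] [Algebra k A]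

/-- The operated ideal generated by `S`: the smallest two-sided ideal that contains `S` and is
stable under all the operators `P ω`. -/
def operatedIdeal (P : Ω → A →ₗ[k] A) (S : Set A) : TwoSidedIdeal A :=
  sInf {I : TwoSidedIdeal A | S ⊆ (I : Set A) ∧ ∀ (ω : Ω) (a : A), a ∈ I → P ω a ∈ I}

theorem operator_mem_operatedIdeal (P : Ω → A →ₗ[k] A) (S : Set A) (ω : Ω) {a : A}
    (ha : a ∈ operatedIdeal P S) : P ω a ∈ operatedIdeal P S := by
  unfold operatedIdeal at *
  rw [TwoSidedIdeal.mem_sInf] at *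
  intro I hI
  exact hI.2 ω a (ha I hI)

/-- The quotient algebra `A / Id(S)`. -/
abbrev OperatedQuotient (P : Ω → A →ₗ[k] A) (S : Set A) : Type _ :=
  (operatedIdeal P S).ringCon.Quotient

/-- The quotient map `A → A / Id(S)`. -/
def toQuotient (P : Ω → A →ₗ[k] A) (S : Set A) : A →+* OperatedQuotient P S :=
  (operatedIdeal P S).ringCon.mk'

/-- The operator on `A / Id(S)` induced by `P ω`. -/
def quotientOperator (P : Ω → A →ₗ[k] A) (S : Set A) (ω : Ω) :
    OperatedQuotient P S →ₗ[k] OperatedQuotient P S where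
  toFun := Quotient.map' (P ω) (fun a b h => by
    have h' : a - b ∈ operatedIdeal P S := (TwoSidedIdeal.rel_iff _ a b).1 h
    refine (TwoSidedIdeal.rel_iff _ _ _).2 ?_
    rw [← map_sub]
    exact operator_mem_operatedIdeal P S ω h')
  map_add' := by
    rintro ⟨a⟩ ⟨b⟩
    exact congrArg (toQuotient P S) (map_add (P ω) a b)
  map_smul' := by
    rintro c ⟨a⟩
    exact congrArg (toQuotient P S) (map_smul (P ω) c a)

end Operated

/-! ### Bracketed words -/

/-- The indecomposable bracketed words: the elements `x` of `X`, and the bracketed words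
`⌊w⌋_ω`, where `w` is a product (a list) of indecomposable ones. -/
inductive Letter (X Ω : Type*) : Type _
  | var (x : X) : Letter X Ω
  | br (ω : Ω) (w : List (Letter X Ω)) : Letter X Ω

/-- The monoid `𝔐(X, Ω) = M(X ⊔ ⨆_ω ⌊𝔐(X, Ω)⌋_ω)` of `Ω`-bracketed words in `X`. -/
abbrev Word (X Ω : Type*) : Type _ := FreeMonoid (Letter X Ω)

section Words

variable {X Ω : Type*}

/-- The bracketed word `x`. -/
def varWord (x : X) : Word X Ω := FreeMonoid.of (Letter.var x)

/-- The bracketed word `⌊w⌋_ω`. -/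
def bracket (ω : Ω) (w : Word X Ω) : Word X Ω := FreeMonoid.of (Letter.br ω w.toList)

mutual
/-- The number of occurrences of elements of `X` and of brackets in a letter. -/
def Letter.deg : Letter X Ω → ℕ
  | .var _ => 1
  | .br _ w => wordDeg w + 1
/-- The total degree: the number of occurrences of elements of `X` and of brackets. -/
def wordDeg : List (Letter X Ω) → ℕ
  | [] => 0
  | a :: w => a.deg + wordDeg w
end

mutual
/-- The number of occurrences of brackets in a letter. -/
def Letter.degP : Letter X Ω → ℕ
  | .var _ => 0
  | .br _ w => wordDegP w + 1
/-- The `P`-degree: the number of occurrences of brackets. -/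
def wordDegP : List (Letter X Ω) → ℕ
  | [] => 0
  | a :: w => a.degP + wordDegP w
end

/-- For `u = u₀ ⌊u₁*⌋_{α₁} u₁ ⋯ ⌊u_r*⌋_{α_r} u_r` with `u_i ∈ M(X)`, the list
`[(α₁, u₁*), …, (α_r, u_r*)]`. Its length `r` is the `P`-breadth of `u`. -/
def bracketFactors : List (Letter X Ω) → List (Ω × List (Letter X Ω))
  | [] => []
  | .var _ :: w => bracketFactors w
  | .br ω v :: w => (ω, v) :: bracketFactors w

/-- For `u = u₀ ⌊u₁*⌋_{α₁} u₁ ⋯ ⌊u_r*⌋_{α_r} u_r` with `u_i ∈ M(X)`, the list `[u₀, …, u_r]`. -/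
def varFactors : List (Letter X Ω) → List (List X)
  | [] => [[]]
  | .var x :: w => (varFactors w).modifyHead (x :: ·)
  | .br _ _ :: w => [] :: varFactors w

/-- The strict order `<_db` on bracketed words built from strict orders on `X` and `Ω`: compare
the `P`-degrees, then the `P`-breadths, then lexicographically the sequences
`(α₁, u₁*, …, α_r, u_r*, u₀, …, u_r)`, where the `u_i*` are compared by `<_db` and the
`u_i ∈ M(X)` by the degree lexicographical order. -/
inductive DbLt (rX : X → X → Prop) (rΩ : Ω → Ω → Prop) :
    List (Letter X Ω) → List (Letter X Ω) → Prop
  | degP {u v} : wordDegP u < wordDegP v → DbLt rX rΩ u v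
  | breadth {u v} : wordDegP u = wordDegP v →
      (bracketFactors u).length < (bracketFactors v).length → DbLt rX rΩ u v
  | brackets {u v} : wordDegP u = wordDegP v →
      (bracketFactors u).length = (bracketFactors v).length →
      List.Lex (Prod.Lex rΩ (DbLt rX rΩ)) (bracketFactors u) (bracketFactors v) →
      DbLt rX rΩ u v
  | vars {u v} : bracketFactors u = bracketFactors v →
      List.Lex (List.Shortlex rX) (varFactors u) (varFactors v) → DbLt rX rΩ u v

/-- The `⋆`-bracketed words, that is, the bracketed words on `X ⊔ {⋆}` with exactly one
occurrence of `⋆`: either `l ⋆ r`, or `l ⌊q⌋_ω r` with `q` a `⋆`-bracketed word, where `l` and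
`r` are bracketed words on `X`. -/
inductive StarWord (X Ω : Type*) : Type _
  | star (l r : Word X Ω) : StarWord X Ω
  | br (l : Word X Ω) (ω : Ω) (q : StarWord X Ω) (r : Word X Ω) : StarWord X Ω

/-- `q.subst u` is `q|_u`, the result of replacing `⋆` in `q` by `u`. -/
def StarWord.subst : StarWord X Ω → Word X Ω → Word X Ω
  | .star l r, u => l * u * r
  | .br l ω q r, u => l * bracket ω (q.subst u) * r

/-! ### Matching Rota-Baxter words -/

/-- `⌊U⌋_Ω`, the set of all `⌊u⌋_ω` with `u ∈ U` and `ω ∈ Ω`. -/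
def bracketSet (U : Set (Word X Ω)) : Set (Word X Ω) := {w | ∃ ω, ∃ u ∈ U, w = bracket ω u}

variable (X Ω) in
/-- The free monoid `M(X)` inside `𝔐(X, Ω)`. -/
def varWords : Set (Word X Ω) := Set.range (FreeMonoid.map (Letter.var (X := X) (Ω := Ω)))

variable (X Ω) in
/-- The free semigroup `S(X)` inside `𝔐(X, Ω)`. -/
def varSemigroup : Set (Word X Ω) := varWords X Ω \ {1}

/-- The alternating products `Λ(Y, Z)`. Products and powers of sets are elementwise. -/
def alternating (Y Z : Set (Word X Ω)) : Set (Word X Ω) :=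
  (⋃ r ≥ (1 : ℕ), (Y * bracketSet Z) ^ r) ∪ (⋃ r : ℕ, (Y * bracketSet Z) ^ r * Y) ∪
    (⋃ r ≥ (1 : ℕ), (bracketSet Z * Y) ^ r) ∪ (⋃ r : ℕ, (bracketSet Z * Y) ^ r * bracketSet Z) ∪ {1}

variable (X Ω) in
/-- `𝔛_0 = M(X)` and `𝔛_n = Λ(S(X), 𝔛_{n-1})`. -/
def mrbWordsLevel : ℕ → Set (Word X Ω)
  | 0 => varWords X Ω
  | n + 1 => alternating (varSemigroup X Ω) (mrbWordsLevel n)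

variable (X Ω) in
/-- `𝔛_∞`, the set of matching Rota-Baxter words. -/
def mrbWords : Set (Word X Ω) := ⋃ n, mrbWordsLevel X Ω n

end Words

/-! ### The operated algebra `k𝔐(X, Ω)` and its quotient -/

section Algebra

variable {k X Ω : Type*} [CommRing k]

/-- The element of `k𝔐(X, Ω)` given by a bracketed word. -/
noncomputable def monomial (k : Type*) [CommRing k] {X Ω : Type*} (w : Word X Ω) :
    MonoidAlgebra k (Word X Ω) := MonoidAlgebra.of k (Word X Ω) w

/-- The linear operator `P_ω` on `k𝔐(X, Ω)` with `P_ω(w) = ⌊w⌋_ω`. -/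
noncomputable def bracketOp (k X : Type*) {Ω : Type*} [CommRing k] (ω : Ω) :
    MonoidAlgebra k (Word X Ω) →ₗ[k] MonoidAlgebra k (Word X Ω) :=
  MonoidAlgebra.mapDomainLinearMap k k (bracket ω)

/-- The set `S` of the matching Rota-Baxter relations of weight `lam`. -/
def relations (X : Type*) (lam : Ω → k) : Set (MonoidAlgebra k (Word X Ω)) :=
  {s | ∃ (x y : Word X Ω) (α β : Ω),
    s = monomial k (bracket α x * bracket β y) - monomial k (bracket α (x * bracket β y))
      - monomial k (bracket β (bracket α x * y)) - lam β • monomial k (bracket α (x * y))}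

/-- `w` is the leading word of `f` for the order `≤_db`: the largest word that occurs in `f`. -/
def IsLeadingWord (rX : X → X → Prop) (rΩ : Ω → Ω → Prop) (f : MonoidAlgebra k (Word X Ω))
    (w : Word X Ω) : Prop :=
  w ∈ f.coeff.support ∧ ∀ v ∈ f.coeff.support, v = w ∨ DbLt rX rΩ v.toList w.toList

/-- `Irr(S)`: the bracketed words that are not of the form `q|_{s̄}`, where `s̄` is the leading word
of some `s ∈ S`. -/
def Irr (rX : X → X → Prop) (rΩ : Ω → Ω → Prop) (S : Set (MonoidAlgebra k (Word X Ω))) :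
    Set (Word X Ω) :=
  {w | ∀ q : StarWord X Ω, ∀ s ∈ S, ∀ u, IsLeadingWord rX rΩ s u → w ≠ q.subst u}

/-- The algebra `k𝔐(X, Ω) / Id(S)`. -/
abbrev FreeMRB (X : Type*) (lam : Ω → k) : Type _ :=
  OperatedQuotient (bracketOp k X (Ω := Ω)) (relations X lam)

/-- The quotient map `k𝔐(X, Ω) → k𝔐(X, Ω) / Id(S)`. -/
noncomputable def FreeMRB.mk (lam : Ω → k) :
    MonoidAlgebra k (Word X Ω) →+* FreeMRB X lam :=
  toQuotient (bracketOp k X (Ω := Ω)) (relations X lam)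

/-- The operator `P_ω` on `k𝔐(X, Ω) / Id(S)`. -/
noncomputable def FreeMRB.op (X : Type*) (lam : Ω → k) (ω : Ω) : FreeMRB X lam →ₗ[k] FreeMRB X lam :=
  quotientOperator (bracketOp k X (Ω := Ω)) (relations X lam) ω

/-! ### The product `⋄` -/

theorem deg_le_of_getLast? {w : List (Letter X Ω)} {a : Letter X Ω} (h : w.getLast? = some a) :
    a.deg ≤ wordDeg w := by
  induction w with
  | nil => simp at h
  | cons b w ih =>
    cases w with
    | nil => simp at h; subst h; simp [wordDeg]
    | cons c w =>
      have := ih (by simpa [List.getLast?_cons_cons] using h)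
      simp only [wordDeg] at this ⊢
      omega

theorem deg_le_of_head? {w : List (Letter X Ω)} {a : Letter X Ω} (h : w.head? = some a) :
    a.deg ≤ wordDeg w := by
  cases w with
  | nil => simp at h
  | cons b w => simp at h; subst h; simp [wordDeg]

/-- The product `w ⋄ w'` of `w = w₁ ⋯ w_m` and `w' = w'₁ ⋯ w'_{m'}`. If `w_m = ⌊u⌋_α` and
`w'₁ = ⌊v⌋_β`, then `w ⋄ w' = w₁ ⋯ w_{m-1} (w_m ⋄ w'₁) w'₂ ⋯ w'_{m'}` with
`w_m ⋄ w'₁ = ⌊u ⋄ w'₁⌋_α + ⌊w_m ⋄ v⌋_β + λ_β ⌊u ⋄ v⌋_α`. In all other cases (`w_m` or `w'₁` is in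
`X`, or `w` or `w'` is empty) it is the concatenation `w w'`. -/
noncomputable def diamond (lam : Ω → k) (w w' : List (Letter X Ω)) :
    MonoidAlgebra k (Word X Ω) :=
  match _h : w.getLast?, _h' : w'.head? with
  | some (.br α u), some (.br β v) =>
      monomial k (FreeMonoid.ofList w.dropLast) *
        (bracketOp k X α (diamond lam u [.br β v]) + bracketOp k X β (diamond lam [.br α u] v)
          + lam β • bracketOp k X α (diamond lam u v)) *
        monomial k (FreeMonoid.ofList w'.tail)
  | _, _ => monomial k (FreeMonoid.ofList (w ++ w'))
termination_by wordDeg w + wordDeg w'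
decreasing_by
  all_goals
    have h1 := deg_le_of_getLast? _h
    have h2 := deg_le_of_head? _h'
    simp only [Letter.deg, wordDeg] at *
    omega

end Algebra

end MatchingRB

-- The words in `𝔛_∞`, the words avoiding `⌊u⌋_α⌊v⌋_β` as a factor at any depth, and `Irr(S)` are
-- all compared with one predicate, `WordGood`. For `𝔛_∞` this is a matter of splitting a word into
-- alternating runs of variables and single brackets (`mem_mrbWords_iff`). For `Irr(S)` it suffices
-- that the leading word of each relation is `⌊x⌋_α⌊y⌋_β`: it has `P`-breadth 2, while the other
-- three words have `P`-breadth 1 and no larger `P`-degree. The comparison therefore never reaches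
-- the orders on `X` and `Ω` (`isLeadingWord_relation`).
--
-- Freeness is formal: evaluation of words in a matching Rota-Baxter algebra kills `Id(S)`, and the
-- quotient is generated by `X` under products and operators.
--
-- The basis is obtained from a model, without a confluence argument. The product `⋄` is extended
-- bilinearly to all of `k𝔐`, including words with adjacent brackets. Its recursion is the matching
-- Rota-Baxter equation for brackets, so the only real work is associativity
-- (`DiamondAssoc.bracketOp`, `diamondMul_assoc_monomial`). The universal property then gives a
-- homomorphism from the quotient to this model. It sends the class of each good word to that word
-- itself (`evalWord_diamond_of_wordGood`), whence linear independence. For spanning, `⋄` computes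
-- the product of the quotient (`FreeMRB.mk_diamond`) and preserves the span of the good words
-- (`diamond_mem_mrbSpan`). The image of that span is therefore closed under products and operators,
-- and it contains `1` and `X`. The same two lemmas give the multiplication table.

namespace MatchingRB

-- Words without adjacent brackets, `𝔛_∞` and `Irr(S)`.

section GoodWords

variable {X Ω : Type*}

/-- The letter is a bracketed word `⌊w⌋_ω`. -/
def Letter.IsBracket : Letter X Ω → Prop
  | .var _ => False
  | .br _ _ => True

/-- The letters `a` and `b` are not both bracketed words. -/
def NotBothBrackets (a b : Letter X Ω) : Prop := ¬(a.IsBracket ∧ b.IsBracket)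

/-- No two bracketed factors are adjacent in the letter, at any level of nesting. -/
inductive Letter.Good : Letter X Ω → Prop
  | var (x : X) : Letter.Good (.var x)
  | br (ω : Ω) (w : List (Letter X Ω)) : (∀ a ∈ w, Letter.Good a) → w.IsChain NotBothBrackets →
      Letter.Good (.br ω w)

/-- No two bracketed factors are adjacent in the word, at any level of nesting. -/
def WordGood (w : List (Letter X Ω)) : Prop :=
  (∀ a ∈ w, a.Good) ∧ w.IsChain NotBothBrackets

theorem Letter.good_br_iff {ω : Ω} {w : List (Letter X Ω)} :
    (Letter.br ω w).Good ↔ WordGood w := by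
  constructor
  · intro h
    cases h with
    | br _ _ h1 h2 => exact ⟨h1, h2⟩
  · rintro ⟨h1, h2⟩
    exact .br ω w h1 h2

theorem wordGood_nil : WordGood ([] : List (Letter X Ω)) := by simp [WordGood]

theorem wordGood_singleton {a : Letter X Ω} : WordGood [a] ↔ a.Good := by simp [WordGood]

theorem wordGood_append {u v : List (Letter X Ω)} :
    WordGood (u ++ v) ↔ WordGood u ∧ WordGood v ∧
      ∀ a ∈ u.getLast?, ∀ b ∈ v.head?, NotBothBrackets a b := by
  simp only [WordGood, List.mem_append, List.isChain_append]
  grind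

theorem wordGood_cons {a : Letter X Ω} {w : List (Letter X Ω)} :
    WordGood (a :: w) ↔ WordGood [a] ∧ WordGood w ∧
      ∀ a' ∈ [a].getLast?, ∀ b ∈ w.head?, NotBothBrackets a' b :=
  wordGood_append (u := [a])

theorem wordGood_append_of_head {u v : List (Letter X Ω)} (hu : WordGood u) (hv : WordGood v)
    (h : ∀ b ∈ v.head?, ¬ b.IsBracket) : WordGood (u ++ v) :=
  wordGood_append.2 ⟨hu, hv, fun _ _ b hb hab => h b hb hab.2⟩

theorem wordGood_append_of_getLast {u v : List (Letter X Ω)} (hu : WordGood u) (hv : WordGood v)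
    (h : ∀ a ∈ u.getLast?, ¬ a.IsBracket) : WordGood (u ++ v) :=
  wordGood_append.2 ⟨hu, hv, fun a ha _ _ hab => h a ha hab.1⟩

theorem wordGood_of_forall_not_isBracket {w : List (Letter X Ω)} (h : ∀ a ∈ w, ¬ a.IsBracket) :
    WordGood w := by
  refine ⟨fun a ha => ?_, ?_⟩
  · cases a with
    | var x => exact .var x
    | br ω v => exact absurd trivial (h _ ha)
  · induction w with
    | nil => simp
    | cons a w ih =>
      exact List.isChain_cons.2
        ⟨fun b _ hab => h a (by simp) hab.1, ih fun b hb => h b (by simp [hb])⟩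

theorem wordDeg_append (u v : List (Letter X Ω)) : wordDeg (u ++ v) = wordDeg u + wordDeg v := by
  induction u with
  | nil => simp [wordDeg]
  | cons a u ih => simp [wordDeg, ih, add_assoc]

theorem Letter.deg_pos (a : Letter X Ω) : 0 < a.deg := by cases a <;> simp [Letter.deg]

theorem Letter.deg_le_of_mem {a : Letter X Ω} {w : List (Letter X Ω)} (h : a ∈ w) :
    a.deg ≤ wordDeg w := by
  obtain ⟨l, r, rfl⟩ := List.append_of_mem h
  simp [wordDeg_append, wordDeg]
  omega

theorem not_wordGood_subst (q : StarWord X Ω) (u v : Word X Ω) (α β : Ω) :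
    ¬ WordGood (q.subst (bracket α u * bracket β v)).toList := by
  induction q with
  | star l r =>
    intro h
    simp only [StarWord.subst, FreeMonoid.toList_mul, wordGood_append] at h
    exact h.1.2.1.2.2 (.br α u.toList) (by simp [bracket]) (.br β v.toList) (by simp [bracket])
      ⟨trivial, trivial⟩
  | br l ω q r ih =>
    intro h
    simp only [StarWord.subst, FreeMonoid.toList_mul, wordGood_append] at h
    exact ih (Letter.good_br_iff.1 (wordGood_singleton.1 h.1.2.1))

/-- A word fails to be good either because two of its own letters are adjacent brackets, or because
some letter `⌊v⌋_ω` has a bad interior. In the second case `v` has smaller degree and the pattern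
found in it is wrapped in `ω`. The bound `n` serves for induction on degree. -/
theorem exists_subst_of_not_wordGood (n : ℕ) (w : List (Letter X Ω)) (hn : wordDeg w ≤ n)
    (hw : ¬ WordGood w) : ∃ (q : StarWord X Ω) (u v : Word X Ω) (α β : Ω),
      FreeMonoid.ofList w = q.subst (bracket α u * bracket β v) := by
  induction n generalizing w with
  | zero =>
    cases w with
    | nil => exact absurd wordGood_nil hw
    | cons a w =>
      have := a.deg_pos
      simp only [wordDeg] at hn
      omega
  | succ n ih =>
    by_cases h : ∀ a ∈ w, a.Good
    · have hc : ¬ w.IsChain NotBothBrackets := fun hc => hw ⟨h, hc⟩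
      -- Locating an adjacent pair at top level is a separate induction along the list, independent
      -- of the degree.
      clear hw ih h hn
      induction w with
      | nil => simp at hc
      | cons a w ih =>
        by_cases hc' : w.IsChain NotBothBrackets
        · cases w with
          | nil => simp at hc
          | cons b w =>
            rw [List.isChain_cons_cons, and_iff_left hc', NotBothBrackets, not_not] at hc
            cases a with
            | var x => exact hc.1.elim
            | br α u =>
              cases b with
              | var x => exact hc.2.elim
              | br β v =>
                exact ⟨.star 1 (FreeMonoid.ofList w), FreeMonoid.ofList u, FreeMonoid.ofList v,
                  α, β, rfl⟩
        · obtain ⟨q, u, v, α, β, hq⟩ := ih hc'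
          have hcons : FreeMonoid.ofList (a :: w) = FreeMonoid.of a * FreeMonoid.ofList w := rfl
          rw [hcons, hq]
          cases q with
          | star l r =>
            exact ⟨.star (FreeMonoid.of a * l) r, u, v, α, β, by simp [StarWord.subst, mul_assoc]⟩
          | br l ω q r =>
            exact ⟨.br (FreeMonoid.of a * l) ω q r, u, v, α, β,
              by simp [StarWord.subst, mul_assoc]⟩
    · push Not at h
      obtain ⟨a, ha, hg⟩ := h
      cases a with
      | var x => exact absurd (.var x) hg
      | br ω v =>
        have hdeg := Letter.deg_le_of_mem ha
        simp only [Letter.deg] at hdeg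
        obtain ⟨q, u, u', α, β, hq⟩ := ih v (by omega) fun hv => hg (Letter.good_br_iff.2 hv)
        obtain ⟨l, r, rfl⟩ := List.append_of_mem ha
        refine ⟨.br (FreeMonoid.ofList l) ω q (FreeMonoid.ofList r), u, u', α, β, ?_⟩
        rw [StarWord.subst, ← hq]
        simp [bracket, FreeMonoid.ofList_append, FreeMonoid.ofList_cons, mul_assoc]

theorem setOf_wordGood_eq :
    {w : Word X Ω | WordGood w.toList} = {w | ∀ (q : StarWord X Ω) (u v : Word X Ω) (α β : Ω),
      w ≠ q.subst (bracket α u * bracket β v)} := by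
  ext w
  simp only [Set.mem_ofPred_eq]
  constructor
  · rintro h q u v α β rfl
    exact not_wordGood_subst q u v α β h
  · intro h
    by_contra hw
    obtain ⟨q, u, v, α, β, hq⟩ := exists_subst_of_not_wordGood _ w.toList le_rfl hw
    exact h q u v α β hq

/-! ### Matching Rota-Baxter words are the words without adjacent brackets -/

theorem forall_not_isBracket_of_mem_varWords {w : Word X Ω} (h : w ∈ varWords X Ω) :
    ∀ a ∈ w.toList, ¬ a.IsBracket := by
  obtain ⟨v, rfl⟩ := h
  simp only [FreeMonoid.toList_map, List.mem_map]
  rintro _ ⟨x, _, rfl⟩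
  exact id

theorem varWord_mul_mem_varSemigroup (x : X) {w : Word X Ω} (h : w ∈ varWords X Ω) :
    varWord x * w ∈ varSemigroup X Ω := by
  obtain ⟨v, rfl⟩ := h
  refine ⟨⟨FreeMonoid.of x * v, by simp [varWord]⟩, fun h => ?_⟩
  have := congrArg FreeMonoid.toList (Set.mem_singleton_iff.1 h)
  simp [varWord] at this

/-- The good words that do not begin with a bracketed word. -/
def goodHead (X Ω : Type*) : Submonoid (Word X Ω) where
  carrier := {w | WordGood w.toList ∧ ∀ b ∈ w.toList.head?, ¬ b.IsBracket}
  one_mem' := by simp [wordGood_nil]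
  mul_mem' := by
    rintro u v ⟨hu, hu'⟩ ⟨hv, hv'⟩
    refine ⟨wordGood_append_of_head hu hv hv', ?_⟩
    simp only [FreeMonoid.toList_mul, List.head?_append, Option.mem_def, Option.or_eq_some_iff]
    rintro b (h | ⟨-, h⟩)
    · exact hu' b h
    · exact hv' b h

/-- The good words that do not end with a bracketed word. -/
def goodLast (X Ω : Type*) : Submonoid (Word X Ω) where
  carrier := {w | WordGood w.toList ∧ ∀ a ∈ w.toList.getLast?, ¬ a.IsBracket}
  one_mem' := by simp [wordGood_nil]
  mul_mem' := by
    rintro u v ⟨hu, hu'⟩ ⟨hv, hv'⟩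
    refine ⟨wordGood_append_of_getLast hu hv hu', ?_⟩
    simp only [FreeMonoid.toList_mul, List.getLast?_append]
    grind

theorem pow_subset_submonoid {M : Type*} [Monoid M] {A : Set M} {N : Submonoid M}
    (h : A ⊆ N) (n : ℕ) : A ^ n ⊆ N := by
  induction n with
  | zero => simp
  | succ n ih =>
    rw [pow_succ]
    exact Set.mul_subset_iff.2 fun a ha b hb => N.mul_mem (ih ha) (h hb)

/-- Elements of `S(X)⌊Z⌋` start with a variable and elements of `⌊Z⌋S(X)` end with one. Good words
with either property form a submonoid, so all powers stay good, and the optional last factor creates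
no adjacent brackets. -/
theorem wordGood_of_mem_alternating {Z : Set (Word X Ω)} (hZ : ∀ z ∈ Z, WordGood z.toList)
    {w : Word X Ω} (hw : w ∈ alternating (varSemigroup X Ω) Z) : WordGood w.toList := by
  have hYv : ∀ y ∈ varSemigroup X Ω, ∀ a ∈ y.toList, ¬ a.IsBracket := fun y hy =>
    forall_not_isBracket_of_mem_varWords hy.1
  have hYg : ∀ y ∈ varSemigroup X Ω, WordGood y.toList := fun y hy =>
    wordGood_of_forall_not_isBracket (hYv y hy)
  have hYne : ∀ y ∈ varSemigroup X Ω, y.toList ≠ [] := fun y hy h => hy.2 h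
  have hB : ∀ b ∈ bracketSet Z, WordGood b.toList := by
    rintro _ ⟨ω, u, hu, rfl⟩
    exact wordGood_singleton.2 (Letter.good_br_iff.2 (hZ u hu))
  have hY1 : ∀ y ∈ varSemigroup X Ω, y ∈ goodHead X Ω := fun y hy =>
    ⟨hYg y hy, fun b hb => hYv y hy b (List.mem_of_mem_head? hb)⟩
  have h1 : varSemigroup X Ω * bracketSet Z ⊆ goodHead X Ω := by
    refine Set.mul_subset_iff.2 fun y hy b hb => ⟨?_, ?_⟩
    · exact wordGood_append_of_getLast (hYg y hy) (hB b hb)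
        fun a ha => hYv y hy a (List.mem_of_mem_getLast? ha)
    · rw [FreeMonoid.toList_mul, List.head?_append_of_ne_nil _ (hYne y hy)]
      exact fun b hb => hYv y hy b (List.mem_of_mem_head? hb)
  have h2 : bracketSet Z * varSemigroup X Ω ⊆ goodLast X Ω := by
    refine Set.mul_subset_iff.2 fun b hb y hy => ⟨?_, ?_⟩
    · exact wordGood_append_of_head (hB b hb) (hYg y hy)
        fun a ha => hYv y hy a (List.mem_of_mem_head? ha)
    · rw [FreeMonoid.toList_mul, List.getLast?_append_of_ne_nil _ (hYne y hy)]
      exact fun b hb => hYv y hy b (List.mem_of_mem_getLast? hb)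
  rcases hw with (((hw | hw) | hw) | hw) | hw
  · simp only [Set.mem_iUnion] at hw
    obtain ⟨r, _, hw⟩ := hw
    exact (pow_subset_submonoid h1 r hw).1
  · simp only [Set.mem_iUnion] at hw
    obtain ⟨r, u, hu, y, hy, rfl⟩ := hw
    exact ((goodHead X Ω).mul_mem (pow_subset_submonoid h1 r hu) (hY1 y hy)).1
  · simp only [Set.mem_iUnion] at hw
    obtain ⟨r, _, hw⟩ := hw
    exact (pow_subset_submonoid h2 r hw).1
  · simp only [Set.mem_iUnion] at hw
    obtain ⟨r, u, hu, b, hb, rfl⟩ := hw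
    have := pow_subset_submonoid h2 r hu
    exact wordGood_append_of_getLast this.1 (hB b hb) this.2
  · rw [Set.mem_singleton_iff.1 hw]
    exact wordGood_nil

theorem wordGood_of_mem_mrbWordsLevel (n : ℕ) {w : Word X Ω} (hw : w ∈ mrbWordsLevel X Ω n) :
    WordGood w.toList := by
  induction n generalizing w with
  | zero => exact wordGood_of_forall_not_isBracket (forall_not_isBracket_of_mem_varWords hw)
  | succ n ih => exact wordGood_of_mem_alternating (fun _ => ih) hw

/-- The four shapes are sorted by their first letter so that induction from the left closes. A new
variable either merges into the leading run or opens one before a bracket; a new bracket can only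
precede a variable. The factor standing alone is kept on the left, where letters are added. -/
theorem alternation_of_isChain {Z : Set (Word X Ω)} (w : List (Letter X Ω))
    (hw : w.IsChain NotBothBrackets)
    (hZ : ∀ ω v, Letter.br ω v ∈ w → FreeMonoid.ofList v ∈ Z) :
    w = [] ∨
    ((∃ x w', w = .var x :: w') ∧ ∃ r : ℕ,
      FreeMonoid.ofList w ∈ varSemigroup X Ω * (bracketSet Z * varSemigroup X Ω) ^ r ∨
      FreeMonoid.ofList w ∈ (varSemigroup X Ω * bracketSet Z) ^ (r + 1)) ∨
    ((∃ ω v w', w = .br ω v :: w') ∧ ∃ r : ℕ,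
      FreeMonoid.ofList w ∈ (bracketSet Z * varSemigroup X Ω) ^ (r + 1) ∨
      FreeMonoid.ofList w ∈ bracketSet Z * (varSemigroup X Ω * bracketSet Z) ^ r) := by
  induction w with
  | nil => exact .inl rfl
  | cons a w ih =>
    right
    have hih := ih (List.isChain_cons.1 hw).2 fun ω v h => hZ ω v (by simp [h])
    cases a with
    | var x =>
      left
      refine ⟨⟨x, w, rfl⟩, ?_⟩
      have hcons : FreeMonoid.ofList (Letter.var x :: w) = varWord x * FreeMonoid.ofList w := rfl
      have hx : (varWord x : Word X Ω) ∈ varSemigroup X Ω := by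
        simpa using varWord_mul_mem_varSemigroup (Ω := Ω) x ⟨1, map_one _⟩
      rw [hcons]
      rcases hih with rfl | ⟨-, r, h | h⟩ | ⟨-, r, h | h⟩
      · exact ⟨0, .inl (by simpa using hx)⟩
      · obtain ⟨y, hy, z, hz, h⟩ := h
        refine ⟨r, .inl ⟨varWord x * y, varWord_mul_mem_varSemigroup x hy.1, z, hz, ?_⟩⟩
        simp only [← h, mul_assoc]
      · rw [pow_succ', mul_assoc] at h
        obtain ⟨y, hy, z, hz, h⟩ := h
        refine ⟨r, .inr ?_⟩
        rw [pow_succ', mul_assoc]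
        refine ⟨varWord x * y, varWord_mul_mem_varSemigroup x hy.1, z, hz, ?_⟩
        simp only [← h, mul_assoc]
      · exact ⟨r + 1, .inl (Set.mul_mem_mul hx h)⟩
      · refine ⟨r, .inr ?_⟩
        rw [pow_succ', mul_assoc]
        exact Set.mul_mem_mul hx h
    | br ω v =>
      right
      refine ⟨⟨ω, v, w, rfl⟩, ?_⟩
      have hcons : FreeMonoid.ofList (Letter.br ω v :: w) =
        bracket ω (FreeMonoid.ofList v) * FreeMonoid.ofList w := rfl
      have hb : bracket ω (FreeMonoid.ofList v) ∈ bracketSet Z :=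
        ⟨ω, _, hZ ω v (by simp), rfl⟩
      rw [hcons]
      rcases hih with rfl | ⟨-, r, h | h⟩ | ⟨⟨ω', v', w', rfl⟩, -⟩
      · exact ⟨0, .inr (by simpa using hb)⟩
      · refine ⟨r, .inl ?_⟩
        rw [pow_succ', mul_assoc]
        exact Set.mul_mem_mul hb h
      · exact ⟨r + 1, .inr (Set.mul_mem_mul hb h)⟩
      · exact absurd ⟨trivial, trivial⟩ ((List.isChain_cons_cons.1 hw).1)

/-- The total degree bounds the nesting depth, and passing inside a bracket lowers it by at least
one, so it can serve as the level. -/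
theorem mem_mrbWordsLevel_of_wordGood (n : ℕ) (w : List (Letter X Ω)) (hw : WordGood w)
    (hn : wordDeg w ≤ n) : FreeMonoid.ofList w ∈ mrbWordsLevel X Ω n := by
  induction n generalizing w with
  | zero =>
    cases w with
    | nil => exact ⟨1, map_one _⟩
    | cons a w =>
      have := a.deg_pos
      simp only [wordDeg] at hn
      omega
  | succ n ih =>
    have hZ : ∀ ω v, Letter.br ω v ∈ w → FreeMonoid.ofList v ∈ mrbWordsLevel X Ω n := by
      intro ω v h
      have hdeg := Letter.deg_le_of_mem h
      simp only [Letter.deg] at hdeg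
      exact ih v (Letter.good_br_iff.1 (hw.1 _ h)) (by omega)
    rw [mrbWordsLevel, alternating]
    simp only [Set.mem_union, Set.mem_iUnion, exists_prop]
    rcases alternation_of_isChain w hw.2 hZ with rfl | ⟨-, r, h | h⟩ | ⟨-, r, h | h⟩
    · exact .inr rfl
    -- `mul_pow_mul` moves the single factor across: `Y(BY)^r = (YB)^r Y`.
    · exact .inl (.inl (.inl (.inr ⟨r, by rwa [mul_pow_mul]⟩)))
    · exact .inl (.inl (.inl (.inl ⟨r + 1, by omega, h⟩)))
    · exact .inl (.inl (.inr ⟨r + 1, by omega, h⟩))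
    · exact .inl (.inr ⟨r, by rwa [mul_pow_mul]⟩)

theorem mem_mrbWords_iff {w : Word X Ω} : w ∈ mrbWords X Ω ↔ WordGood w.toList := by
  rw [mrbWords, Set.mem_iUnion]
  exact ⟨fun ⟨n, h⟩ => wordGood_of_mem_mrbWordsLevel n h,
    fun h => ⟨_, mem_mrbWordsLevel_of_wordGood _ w.toList h le_rfl⟩⟩

theorem mrbWords_eq :
    mrbWords X Ω = {w | ∀ (q : StarWord X Ω) (u v : Word X Ω) (α β : Ω),
      w ≠ q.subst (bracket α u * bracket β v)} := by
  rw [← setOf_wordGood_eq]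
  ext w
  exact mem_mrbWords_iff

/-! ### Leading words of the relations -/

theorem wordDegP_append (u v : List (Letter X Ω)) :
    wordDegP (u ++ v) = wordDegP u + wordDegP v := by
  induction u with
  | nil => simp [wordDegP]
  | cons a u ih => simp [wordDegP, ih, add_assoc]

theorem not_dbLt_of_degP_le_of_breadth_lt {rX : X → X → Prop} {rΩ : Ω → Ω → Prop}
    {u v : List (Letter X Ω)} (h : wordDegP v ≤ wordDegP u)
    (h' : (bracketFactors v).length < (bracketFactors u).length) : ¬ DbLt rX rΩ u v := by
  intro huv
  cases huv with
  | degP h1 => omega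
  | breadth h1 h2 => omega
  | brackets h1 h2 => omega
  | vars h1 => rw [h1] at h'; omega

variable {k : Type*} [CommRing k]

theorem monomial_eq_single (w : Word X Ω) : monomial k w = MonoidAlgebra.single w 1 := rfl

/-- The three subtracted words are single brackets, hence of breadth 1, and their `P`-degree does
not exceed that of the breadth 2 word. They may coincide with one another, but none can cancel the
breadth 2 word, whose coefficient is 1. -/
theorem isLeadingWord_relation [Nontrivial k] (rX : X → X → Prop) (rΩ : Ω → Ω → Prop)
    (lam : Ω → k) (x y : Word X Ω) (α β : Ω) (w : Word X Ω) :
    IsLeadingWord rX rΩ (monomial k (bracket α x * bracket β y)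
      - monomial k (bracket α (x * bracket β y)) - monomial k (bracket β (bracket α x * y))
      - lam β • monomial k (bracket α (x * y))) w ↔ w = bracket α x * bracket β y := by
  classical
  set s := monomial k (bracket α x * bracket β y)
      - monomial k (bracket α (x * bracket β y)) - monomial k (bracket β (bracket α x * y))
      - lam β • monomial k (bracket α (x * y)) with hs
  have hdeg : ∀ (u : Word X Ω) (ω : Ω), wordDegP (bracket ω u).toList = wordDegP u.toList + 1 := by
    intro u ω
    simp [bracket, wordDegP, Letter.degP]
  have hbr : ∀ (u : Word X Ω) (ω : Ω), (bracketFactors (bracket ω u).toList).length = 1 := by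
    intro u ω
    simp [bracket, bracketFactors]
  have hbr2 : (bracketFactors (bracket α x * bracket β y).toList).length = 2 := by
    simp [bracket, bracketFactors]
  have hne : ∀ (u : Word X Ω) (ω : Ω), bracket ω u ≠ bracket α x * bracket β y := by
    intro u ω h
    have := hbr u ω
    rw [h, hbr2] at this
    omega
  -- Both directions are recorded because `rX` and `rΩ` are arbitrary relations here, so asymmetry
  -- of `DbLt` is not available; the second part gives uniqueness of the leading word.
  have hlt : ∀ v ∈ s.coeff.support, v = bracket α x * bracket β y ∨
      (DbLt rX rΩ v.toList (bracket α x * bracket β y).toList ∧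
        ¬ DbLt rX rΩ (bracket α x * bracket β y).toList v.toList) := by
    intro v hv
    by_contra hcon
    push Not at hcon
    obtain ⟨h0, hcon⟩ := hcon
    have key : ∀ (u : Word X Ω) (ω : Ω),
        wordDegP u.toList ≤ wordDegP x.toList + wordDegP y.toList + 1 →
        bracket ω u ≠ v := by
      rintro u ω hu rfl
      have hle : wordDegP (bracket ω u).toList ≤
          wordDegP (bracket α x * bracket β y).toList := by
        rw [FreeMonoid.toList_mul, wordDegP_append, hdeg, hdeg, hdeg]
        omega
      have hblt : (bracketFactors (bracket ω u).toList).length <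
          (bracketFactors (bracket α x * bracket β y).toList).length := by
        rw [hbr, hbr2]
        omega
      refine not_dbLt_of_degP_le_of_breadth_lt hle hblt (hcon ?_)
      rcases hle.lt_or_eq with h | h
      · exact .degP h
      · exact .breadth h hblt
    refine Finsupp.mem_support_iff.1 hv ?_
    have k1 := key (x * bracket β y) α (by
      rw [FreeMonoid.toList_mul, wordDegP_append, hdeg]; omega)
    have k2 := key (bracket α x * y) β (by
      rw [FreeMonoid.toList_mul, wordDegP_append, hdeg]; omega)
    have k3 := key (x * y) α (by rw [FreeMonoid.toList_mul, wordDegP_append]; omega)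
    simp [hs, monomial_eq_single, k1, k2, k3, Ne.symm h0]
  have hmem : bracket α x * bracket β y ∈ s.coeff.support := by
    rw [Finsupp.mem_support_iff]
    simp [hs, monomial_eq_single, hne]
  constructor
  · rintro ⟨hw, hmax⟩
    rcases hlt w hw with h | h
    · exact h
    · rcases hmax _ hmem with h' | h'
      · exact h'.symm
      · exact absurd h' h.2
  · rintro rfl
    exact ⟨hmem, fun v hv => (hlt v hv).imp_right And.left⟩

theorem irr_relations_eq_mrbWords [Nontrivial k] (rX : X → X → Prop) (rΩ : Ω → Ω → Prop)
    (lam : Ω → k) : Irr rX rΩ (relations X lam) = mrbWords X Ω := by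
  rw [mrbWords_eq]
  ext w
  constructor
  · intro h q u v α β
    exact h q _ ⟨u, v, α, β, rfl⟩ _ ((isLeadingWord_relation rX rΩ lam u v α β _).2 rfl)
  · rintro h q s ⟨x, y, α, β, rfl⟩ u hu
    rw [(isLeadingWord_relation rX rΩ lam x y α β u).1 hu]
    exact h q x y α β

end GoodWords

-- The product `⋄` on all of `k𝔐` and its associativity.

section Diamond

variable {k X Ω : Type*} [CommRing k]

theorem monomial_one : monomial k (1 : Word X Ω) = 1 := map_one _

theorem monomial_mul (u v : Word X Ω) : monomial k (u * v) = monomial k u * monomial k v :=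
  map_mul _ _ _

theorem bracketOp_monomial (ω : Ω) (w : Word X Ω) :
    bracketOp k X ω (monomial k w) = monomial k (bracket ω w) :=
  MonoidAlgebra.mapDomainLinearMap_single _ _ _

theorem monomial_induction {p : MonoidAlgebra k (Word X Ω) → Prop} (f : MonoidAlgebra k (Word X Ω))
    (mon : ∀ w : List (Letter X Ω), p (monomial k (FreeMonoid.ofList w)))
    (add : ∀ f g, p f → p g → p (f + g)) (smul : ∀ (c : k) (f), p f → p (c • f)) : p f :=
  MonoidAlgebra.induction_on f mon add smul

theorem diamond_eq_append (lam : Ω → k) {u v : List (Letter X Ω)}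
    (h : ∀ a ∈ u.getLast?, ∀ b ∈ v.head?, NotBothBrackets a b) :
    diamond lam u v = monomial k (FreeMonoid.ofList (u ++ v)) := by
  rw [diamond]
  split
  · next h1 h2 => exact absurd ⟨trivial, trivial⟩ (h _ h1 _ h2)
  · rfl

theorem diamond_nil_left (lam : Ω → k) (v : List (Letter X Ω)) :
    diamond lam [] v = monomial k (FreeMonoid.ofList v) :=
  diamond_eq_append lam (by simp)

theorem diamond_nil_right (lam : Ω → k) (u : List (Letter X Ω)) :
    diamond lam u [] = monomial k (FreeMonoid.ofList u) := by
  simpa using diamond_eq_append lam (u := u) (v := []) (by simp)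

theorem diamond_append_br_cons_br (lam : Ω → k) (l r a b : List (Letter X Ω)) (α β : Ω) :
    diamond lam (l ++ [.br α a]) (.br β b :: r) = monomial k (FreeMonoid.ofList l) *
      (bracketOp k X α (diamond lam a [.br β b]) + bracketOp k X β (diamond lam [.br α a] b)
        + lam β • bracketOp k X α (diamond lam a b)) * monomial k (FreeMonoid.ofList r) := by
  rw [diamond]
  split
  · next h1 h2 =>
    simp only [List.getLast?_append, List.getLast?_singleton, Option.some_or, Option.some.injEq,
      Letter.br.injEq, List.head?_cons] at h1 h2
    obtain ⟨rfl, rfl⟩ := h1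
    obtain ⟨rfl, rfl⟩ := h2
    simp
  · next h => exact absurd rfl (h α a β b (by simp))

theorem diamond_br_br (lam : Ω → k) (a b : List (Letter X Ω)) (α β : Ω) :
    diamond lam [.br α a] [.br β b] =
      bracketOp k X α (diamond lam a [.br β b]) + bracketOp k X β (diamond lam [.br α a] b)
        + lam β • bracketOp k X α (diamond lam a b) := by
  simpa [monomial_one] using diamond_append_br_cons_br lam [] [] a b α β

/-- Either two words meet in two bracketed words, or their product `⋄` is the concatenation. -/
theorem meet_cases (u v : List (Letter X Ω)) :
    (∃ l α a β b r, u = l ++ [.br α a] ∧ v = .br β b :: r) ∨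
      ∀ a ∈ u.getLast?, ∀ b ∈ v.head?, NotBothBrackets a b := by
  rcases List.eq_nil_or_concat u with rfl | ⟨l, a, rfl⟩
  · simp
  rcases v with _ | ⟨b, r⟩
  · simp
  cases a with
  | var x => right; simp [NotBothBrackets, Letter.IsBracket]
  | br α a =>
    cases b with
    | var x => right; simp [NotBothBrackets, Letter.IsBracket]
    | br β b => exact .inl ⟨l, α, a, β, b, r, by simp, rfl⟩

/-- Only the last letter of the left argument takes part in `⋄`. If `u` were empty, that letter
would come from `l`, hence `hu`. -/
theorem diamond_append_left (lam : Ω → k) (l u v : List (Letter X Ω)) (hu : u ≠ []) :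
    diamond lam (l ++ u) v = monomial k (FreeMonoid.ofList l) * diamond lam u v := by
  rcases meet_cases u v with ⟨l', α, a, β, b, r, rfl, rfl⟩ | h
  · rw [← List.append_assoc, diamond_append_br_cons_br, diamond_append_br_cons_br,
      FreeMonoid.ofList_append, monomial_mul]
    simp only [mul_assoc]
  · rw [diamond_eq_append lam h,
      diamond_eq_append lam (by rwa [List.getLast?_append_of_ne_nil _ hu]),
      List.append_assoc, FreeMonoid.ofList_append, monomial_mul]

theorem diamond_append_right (lam : Ω → k) (u v r : List (Letter X Ω)) (hv : v ≠ []) :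
    diamond lam u (v ++ r) = diamond lam u v * monomial k (FreeMonoid.ofList r) := by
  rcases meet_cases u v with ⟨l', α, a, β, b, r', rfl, rfl⟩ | h
  · rw [List.cons_append, diamond_append_br_cons_br, diamond_append_br_cons_br,
      FreeMonoid.ofList_append, monomial_mul]
    simp only [mul_assoc]
  · rw [diamond_eq_append lam h,
      diamond_eq_append lam (by rwa [List.head?_append_of_ne_nil _ hv]),
      ← List.append_assoc, FreeMonoid.ofList_append, monomial_mul]

/-- The bilinear extension of the product `⋄` to `k𝔐(X, Ω)`. -/
noncomputable def diamondMul (lam : Ω → k) : MonoidAlgebra k (Word X Ω) →ₗ[k]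
    MonoidAlgebra k (Word X Ω) →ₗ[k] MonoidAlgebra k (Word X Ω) :=
  (MonoidAlgebra.basis (Word X Ω) k).constr k fun u =>
    (MonoidAlgebra.basis (Word X Ω) k).constr k fun v => diamond lam u.toList v.toList

theorem diamondMul_monomial (lam : Ω → k) (u v : Word X Ω) :
    diamondMul lam (monomial k u) (monomial k v) = diamond lam u.toList v.toList := by
  rw [monomial_eq_single, monomial_eq_single, ← MonoidAlgebra.basis_apply,
    ← MonoidAlgebra.basis_apply, diamondMul, Module.Basis.constr_basis, Module.Basis.constr_basis]

theorem one_diamondMul (lam : Ω → k) (f : MonoidAlgebra k (Word X Ω)) :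
    diamondMul lam 1 f = f := by
  induction f using monomial_induction with
  | mon w => rw [← monomial_one, diamondMul_monomial]; exact diamond_nil_left lam w
  | add f g hf hg => rw [map_add, hf, hg]
  | smul c f hf => rw [map_smul, hf]

theorem diamondMul_one (lam : Ω → k) (f : MonoidAlgebra k (Word X Ω)) :
    diamondMul lam f 1 = f := by
  induction f using monomial_induction with
  | mon w => rw [← monomial_one, diamondMul_monomial]; exact diamond_nil_right lam w
  | add f g hf hg => rw [map_add, LinearMap.add_apply, hf, hg]
  | smul c f hf => rw [map_smul, LinearMap.smul_apply, hf]

/-- Both sides are bilinear, and on words this is the recursion that defines `⋄` on two bracketed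
letters. -/
theorem diamondMul_bracketOp (lam : Ω → k) (α β : Ω) (f g : MonoidAlgebra k (Word X Ω)) :
    diamondMul lam (bracketOp k X α f) (bracketOp k X β g) =
      bracketOp k X α (diamondMul lam f (bracketOp k X β g)) +
        bracketOp k X β (diamondMul lam (bracketOp k X α f) g) +
        lam β • bracketOp k X α (diamondMul lam f g) := by
  induction f using monomial_induction with
  | add f f' hf hf' =>
    simp only [map_add, LinearMap.add_apply, hf, hf', smul_add]
    abel
  | smul c f hf =>
    simp only [map_smul, LinearMap.smul_apply, hf, smul_add, smul_comm c (lam β)]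
  | mon u =>
    induction g using monomial_induction with
    | add g g' hg hg' =>
      simp only [map_add, hg, hg', smul_add]
      abel
    | smul c g hg =>
      simp only [map_smul, hg, smul_add, smul_comm c (lam β)]
    | mon v =>
      simp only [bracketOp_monomial, diamondMul_monomial]
      exact diamond_br_br lam u v α β

theorem diamondMul_mul_right (lam : Ω → k) (f : MonoidAlgebra k (Word X Ω))
    (v r : List (Letter X Ω)) (hv : v ≠ []) :
    diamondMul lam f (monomial k (FreeMonoid.ofList (v ++ r))) =
      diamondMul lam f (monomial k (FreeMonoid.ofList v)) * monomial k (FreeMonoid.ofList r) := by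
  induction f using monomial_induction with
  | mon u => simp only [diamondMul_monomial]; exact diamond_append_right lam u v r hv
  | add f g hf hg => simp only [map_add, LinearMap.add_apply, hf, hg, add_mul]
  | smul c f hf => simp only [map_smul, LinearMap.smul_apply, hf, smul_mul_assoc]

theorem diamondMul_mul_left (lam : Ω → k) (f : MonoidAlgebra k (Word X Ω))
    (l u : List (Letter X Ω)) (hu : u ≠ []) :
    diamondMul lam (monomial k (FreeMonoid.ofList (l ++ u))) f =
      monomial k (FreeMonoid.ofList l) * diamondMul lam (monomial k (FreeMonoid.ofList u)) f := by
  induction f using monomial_induction with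
  | mon v => simp only [diamondMul_monomial]; exact diamond_append_left lam l u v hu
  | add f g hf hg => simp only [map_add, hf, hg, mul_add]
  | smul c f hf => simp only [map_smul, hf, mul_smul_comm]

/-- A nonempty left factor of the second argument of `⋄` absorbs the product. -/
theorem diamondMul_mul_monomial (lam : Ω → k) (f : MonoidAlgebra k (Word X Ω))
    (v w : List (Letter X Ω)) (hv : v ≠ []) :
    diamondMul lam (f * monomial k (FreeMonoid.ofList v)) (monomial k (FreeMonoid.ofList w)) =
      f * diamond lam v w := by
  induction f using monomial_induction with
  | mon u =>
    rw [← monomial_mul, ← FreeMonoid.ofList_append, diamondMul_monomial]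
    exact diamond_append_left lam u v w hv
  | add f g hf hg => simp only [map_add, add_mul, LinearMap.add_apply, hf, hg]
  | smul c f hf => simp only [smul_mul_assoc, map_smul, LinearMap.smul_apply, hf]

theorem diamondMul_monomial_mul (lam : Ω → k) (f : MonoidAlgebra k (Word X Ω))
    (u v : List (Letter X Ω)) (hv : v ≠ []) :
    diamondMul lam (monomial k (FreeMonoid.ofList u)) (monomial k (FreeMonoid.ofList v) * f) =
      diamond lam u v * f := by
  induction f using monomial_induction with
  | mon w =>
    rw [← monomial_mul, ← FreeMonoid.ofList_append, diamondMul_monomial]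
    exact diamond_append_right lam u v w hv
  | add f g hf hg => simp only [map_add, mul_add, hf, hg]
  | smul c f hf => simp only [mul_smul_comm, map_smul, hf]

/-- Every word in `P_α f` is a single letter, so the prefix `l` splits off for arbitrary `f`, not
only for a monomial. -/
theorem diamondMul_monomial_mul_bracketOp (lam : Ω → k) (l : List (Letter X Ω)) (α : Ω)
    (f g : MonoidAlgebra k (Word X Ω)) :
    diamondMul lam (monomial k (FreeMonoid.ofList l) * bracketOp k X α f) g =
      monomial k (FreeMonoid.ofList l) * diamondMul lam (bracketOp k X α f) g := by
  induction f using monomial_induction with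
  | mon u =>
    rw [bracketOp_monomial, ← monomial_mul]
    exact diamondMul_mul_left lam g l [.br α u] (by simp)
  | add f f' hf hf' => simp only [map_add, mul_add, LinearMap.add_apply, hf, hf']
  | smul c f hf => simp only [map_smul, mul_smul_comm, LinearMap.smul_apply, hf]

theorem diamondMul_bracketOp_mul_monomial (lam : Ω → k) (r : List (Letter X Ω)) (α : Ω)
    (f g : MonoidAlgebra k (Word X Ω)) :
    diamondMul lam f (bracketOp k X α g * monomial k (FreeMonoid.ofList r)) =
      diamondMul lam f (bracketOp k X α g) * monomial k (FreeMonoid.ofList r) := by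
  induction g using monomial_induction with
  | mon u =>
    rw [bracketOp_monomial, ← monomial_mul]
    exact diamondMul_mul_right lam f [.br α u] r (by simp)
  | add g g' hg hg' => simp only [map_add, add_mul, hg, hg']
  | smul c g hg => simp only [map_smul, smul_mul_assoc, hg]

theorem diamondMul_append_var (lam : Ω → k) (u : List (Letter X Ω)) (x : X)
    (f : MonoidAlgebra k (Word X Ω)) :
    diamondMul lam (monomial k (FreeMonoid.ofList (u ++ [.var x]))) f =
      monomial k (FreeMonoid.ofList (u ++ [.var x])) * f := by
  induction f using monomial_induction with
  | mon v =>
    rw [diamondMul_monomial, ← monomial_mul]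
    exact diamond_eq_append lam (by simp [NotBothBrackets, Letter.IsBracket])
  | add f g hf hg => rw [map_add, hf, hg, mul_add]
  | smul c f hf => rw [map_smul, hf, mul_smul_comm]

theorem diamondMul_var_cons (lam : Ω → k) (u : List (Letter X Ω)) (x : X)
    (f : MonoidAlgebra k (Word X Ω)) :
    diamondMul lam f (monomial k (FreeMonoid.ofList (.var x :: u))) =
      f * monomial k (FreeMonoid.ofList (.var x :: u)) := by
  induction f using monomial_induction with
  | mon v =>
    rw [diamondMul_monomial, ← monomial_mul]
    exact diamond_eq_append lam (by simp [NotBothBrackets, Letter.IsBracket])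
  | add f g hf hg => rw [map_add, LinearMap.add_apply, hf, hg, add_mul]
  | smul c f hf => rw [map_smul, LinearMap.smul_apply, hf, smul_mul_assoc]

/-- The product `⋄` is associative on the triple `f`, `g`, `h`. -/
def DiamondAssoc (lam : Ω → k) (f g h : MonoidAlgebra k (Word X Ω)) : Prop :=
  diamondMul lam (diamondMul lam f g) h = diamondMul lam f (diamondMul lam g h)

/-- Associativity for three bracketed words, given it for all triples that arise by stripping
outer brackets. -/
theorem DiamondAssoc.bracketOp {lam : Ω → k} {α β γ : Ω} {a b c : MonoidAlgebra k (Word X Ω)}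
    (h1 : DiamondAssoc lam a (bracketOp k X β b) (bracketOp k X γ c))
    (h2 : DiamondAssoc lam (bracketOp k X α a) b (bracketOp k X γ c))
    (h3 : DiamondAssoc lam (bracketOp k X α a) (bracketOp k X β b) c)
    (h4 : DiamondAssoc lam a b (bracketOp k X γ c))
    (h5 : DiamondAssoc lam a (bracketOp k X β b) c)
    (h6 : DiamondAssoc lam (bracketOp k X α a) b c)
    (h7 : DiamondAssoc lam a b c) :
    DiamondAssoc lam (bracketOp k X α a) (bracketOp k X β b) (bracketOp k X γ c) := by
  rw [DiamondAssoc] at *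
  have e := diamondMul_bracketOp lam α β a b
  rw [e] at h3
  simp only [map_add, map_smul, LinearMap.add_apply, LinearMap.smul_apply] at h3
  have e' := diamondMul_bracketOp lam β γ b c
  rw [e'] at h1
  simp only [map_add, map_smul] at h1
  -- Expanding the left-hand side leaves three terms under `P_γ`. They do not match the right-hand
  -- side one by one; only their sum does, and that is `P_γ` applied to the expanded `h3`. The other
  -- hypotheses apply termwise as rewrites.
  have h3' := congrArg (MatchingRB.bracketOp k X γ) h3
  simp only [map_add, map_smul] at h3'
  rw [e, e']
  simp only [map_add, map_smul, LinearMap.add_apply, LinearMap.smul_apply, diamondMul_bracketOp,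
    h1, h2, h4, h5, h6, h7]
  linear_combination (norm := module) h3'

/-- The two products interact only when the middle word is a single letter, and they reduce to
concatenation at a variable. What remains is three meeting brackets, where each of the seven triples
with some brackets stripped has smaller total degree. -/
theorem diamondMul_assoc_monomial (lam : Ω → k) (n : ℕ) (u v w : List (Letter X Ω))
    (hn : wordDeg u + wordDeg v + wordDeg w ≤ n) :
    diamondMul lam (diamondMul lam (monomial k (FreeMonoid.ofList u))
        (monomial k (FreeMonoid.ofList v))) (monomial k (FreeMonoid.ofList w)) =
      diamondMul lam (monomial k (FreeMonoid.ofList u)) (diamondMul lam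
        (monomial k (FreeMonoid.ofList v)) (monomial k (FreeMonoid.ofList w))) := by
  induction n generalizing u v w with
  | zero =>
    cases u with
    | nil => simp only [FreeMonoid.ofList_nil, monomial_one, one_diamondMul]
    | cons a u =>
      have := a.deg_pos
      simp only [wordDeg] at hn
      omega
  | succ n ih =>
    rcases List.eq_nil_or_concat u with rfl | ⟨l, x, rfl⟩
    · simp only [FreeMonoid.ofList_nil, monomial_one, one_diamondMul]
    rw [List.concat_eq_append] at hn ⊢
    rcases w with _ | ⟨z, r⟩
    · simp only [FreeMonoid.ofList_nil, monomial_one, diamondMul_one]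
    rcases v with _ | ⟨y, v⟩
    · simp only [FreeMonoid.ofList_nil, monomial_one, diamondMul_one, one_diamondMul]
    rcases v with _ | ⟨y', v⟩
    -- The middle word is the single letter `y`; `x` and `z` are the letters that meet it.
    · cases x with
      | var x =>
        rw [diamondMul_append_var, diamondMul_append_var,
          diamondMul_mul_monomial lam _ _ _ (by simp),
          diamondMul_monomial]
        rfl
      | br α a =>
      cases z with
      | var x =>
        rw [diamondMul_var_cons, diamondMul_var_cons, diamondMul_monomial_mul lam _ _ _ (by simp),
          diamondMul_monomial]
        rfl
      | br γ c =>
      cases y with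
      | var y =>
        have h1 := diamondMul_append_var lam [] y (monomial k (FreeMonoid.ofList (.br γ c :: r)))
        have h2 := diamondMul_var_cons lam [] y
          (monomial k (FreeMonoid.ofList (l ++ [.br α a])))
        rw [List.nil_append] at h1
        rw [h1, h2, diamondMul_mul_monomial lam _ _ _ (by simp),
          diamondMul_monomial_mul lam _ _ _ (by simp)]
        have h3 := diamondMul_monomial lam (FreeMonoid.ofList [.var y])
          (FreeMonoid.ofList (.br γ c :: r))
        have h4 := diamondMul_monomial lam
          (FreeMonoid.ofList (l ++ [.br α a])) (FreeMonoid.ofList [.var y])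
        simp only [FreeMonoid.toList_ofList] at h3 h4
        -- A variable in the middle turns both products into concatenation.
        rw [← h3, ← h4, h1, h2, mul_assoc]
      | br β b =>
        have hbr : ∀ (ω : Ω) (t : List (Letter X Ω)), monomial k (FreeMonoid.ofList [.br ω t]) =
            bracketOp k X ω (monomial k (FreeMonoid.ofList t)) := fun ω t =>
          (bracketOp_monomial ω _).symm
        simp only [wordDeg_append, wordDeg, Letter.deg] at hn
        have key : DiamondAssoc lam (bracketOp k X α (monomial k (FreeMonoid.ofList a)))
            (bracketOp k X β (monomial k (FreeMonoid.ofList b)))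
            (bracketOp k X γ (monomial k (FreeMonoid.ofList c))) := by
          apply DiamondAssoc.bracketOp
          all_goals
            simp only [← hbr, DiamondAssoc]
            apply ih
            try simp only [wordDeg, Letter.deg]
            omega
        rw [DiamondAssoc] at key
        have hcons : (.br γ c :: r : List (Letter X Ω)) = [.br γ c] ++ r := rfl
        rw [hcons, diamondMul_mul_right lam _ _ _ (by simp),
          diamondMul_mul_right lam _ _ _ (by simp),
          diamondMul_mul_left lam _ _ _ (by simp), diamondMul_mul_left lam _ _ _ (by simp)]
        simp only [hbr]
        -- Once the inner products are written as sums of brackets, `l` and `r` can be pulled out of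
        -- the outer products; the goal is then `key` multiplied by `l` on the left and by `r` on
        -- the right.
        rw [diamondMul_bracketOp lam α β, diamondMul_bracketOp lam β γ] at key ⊢
        simp only [map_add, map_smul, mul_add, add_mul, LinearMap.add_apply, LinearMap.smul_apply,
          mul_smul_comm, smul_mul_assoc,
          diamondMul_monomial_mul_bracketOp, diamondMul_bracketOp_mul_monomial] at key ⊢
        have key' := congrArg (fun t => monomial k (FreeMonoid.ofList l) * t *
          monomial k (FreeMonoid.ofList r)) key
        simpa only [mul_add, add_mul, mul_smul_comm, smul_mul_assoc, mul_assoc] using key'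
    -- With at least two letters in the middle, the left product affects only `y` and the right
    -- product only `y' :: v`, so the two are independent.
    · have hv : FreeMonoid.ofList (y :: y' :: v) =
        FreeMonoid.ofList [y] * FreeMonoid.ofList (y' :: v) := rfl
      have h1 := diamondMul_monomial_mul lam (monomial k (FreeMonoid.ofList (y' :: v)))
        (l ++ [x]) [y] (by simp)
      have h2 := diamondMul_mul_monomial lam (monomial k (FreeMonoid.ofList [y]))
        (y' :: v) (z :: r) (by simp)
      rw [hv, monomial_mul, h1, h2, diamondMul_mul_monomial lam _ _ _ (by simp),
        diamondMul_monomial_mul lam _ _ _ (by simp)]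

theorem diamondMul_assoc (lam : Ω → k) (f g h : MonoidAlgebra k (Word X Ω)) :
    diamondMul lam (diamondMul lam f g) h = diamondMul lam f (diamondMul lam g h) := by
  induction f using monomial_induction with
  | add f f' hf hf' => simp only [map_add, LinearMap.add_apply, hf, hf']
  | smul c f hf => simp only [map_smul, LinearMap.smul_apply, hf]
  | mon u =>
    induction g using monomial_induction with
    | add g g' hg hg' => simp only [map_add, LinearMap.add_apply, hg, hg']
    | smul c g hg => simp only [map_smul, LinearMap.smul_apply, hg]
    | mon v =>
      induction h using monomial_induction with
      | add h h' hh hh' => simp only [map_add, hh, hh']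
      | smul c h hh => simp only [map_smul, hh]
      | mon w => exact diamondMul_assoc_monomial lam _ u v w le_rfl

/-- The module `k𝔐(X, Ω)`, as an algebra with the product `⋄`. -/
def DiamondAlgebra (X : Type*) {Ω : Type*} (_lam : Ω → k) : Type _ := MonoidAlgebra k (Word X Ω)

noncomputable instance (lam : Ω → k) : AddCommGroup (DiamondAlgebra X lam) :=
  inferInstanceAs (AddCommGroup (MonoidAlgebra k (Word X Ω)))

noncomputable instance (lam : Ω → k) : Module k (DiamondAlgebra X lam) :=
  inferInstanceAs (Module k (MonoidAlgebra k (Word X Ω)))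

noncomputable instance (lam : Ω → k) : Ring (DiamondAlgebra X lam) where
  __ := (inferInstance : AddCommGroup (DiamondAlgebra X lam))
  mul f g := diamondMul lam f g
  one := (1 : MonoidAlgebra k (Word X Ω))
  mul_assoc := diamondMul_assoc lam
  one_mul := one_diamondMul lam
  mul_one := diamondMul_one lam
  left_distrib f g h := map_add (diamondMul lam f) g h
  right_distrib f g h := LinearMap.map_add₂ (diamondMul lam) f g h
  zero_mul f := LinearMap.map_zero₂ (diamondMul lam) f
  mul_zero f := map_zero (diamondMul lam f)

noncomputable instance (lam : Ω → k) : Algebra k (DiamondAlgebra X lam) :=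
  Algebra.ofModule (fun c f g => LinearMap.map_smul₂ (diamondMul lam) c f g)
    (fun c f g => map_smul (diamondMul lam f) c g)

/-- The identity map from `k𝔐(X, Ω)` to `k𝔐(X, Ω)` with the product `⋄`. -/
noncomputable def DiamondAlgebra.of (lam : Ω → k) :
    MonoidAlgebra k (Word X Ω) ≃ₗ[k] DiamondAlgebra X lam where
  toFun f := f
  invFun f := f
  map_add' _ _ := rfl
  map_smul' _ _ := rfl

theorem DiamondAlgebra.of_mul_of (lam : Ω → k) (f g : MonoidAlgebra k (Word X Ω)) :
    of lam f * of lam g = of lam (diamondMul lam f g) := rfl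

/-- The operator `P_ω` on `k𝔐(X, Ω)` with the product `⋄`. -/
noncomputable def DiamondAlgebra.op (lam : Ω → k) (ω : Ω) :
    DiamondAlgebra X lam →ₗ[k] DiamondAlgebra X lam :=
  bracketOp k X ω

theorem DiamondAlgebra.op_of (lam : Ω → k) (ω : Ω) (f : MonoidAlgebra k (Word X Ω)) :
    op lam ω (of lam f) = of lam (bracketOp k X ω f) := rfl

theorem DiamondAlgebra.isMatchingRB (lam : Ω → k) :
    IsMatchingRB lam (DiamondAlgebra.op (X := X) lam) :=
  fun α β f g => diamondMul_bracketOp lam α β f g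

end Diamond

-- Evaluation of bracketed words in an algebra with operators.

section Evaluation

variable {k X Ω R : Type*} [CommRing k] [Ring R] [Algebra k R]

mutual
/-- The value of a letter under `x ↦ f x` and `⌊·⌋_ω ↦ Q ω`. -/
noncomputable def evalLetter (f : X → R) (Q : Ω → R →ₗ[k] R) : Letter X Ω → R
  | .var x => f x
  | .br ω w => Q ω (evalWord f Q w)
/-- The value of a word under `x ↦ f x` and `⌊·⌋_ω ↦ Q ω`. -/
noncomputable def evalWord (f : X → R) (Q : Ω → R →ₗ[k] R) : List (Letter X Ω) → R
  | [] => 1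
  | a :: w => evalLetter f Q a * evalWord f Q w
end

theorem lift_evalLetter (f : X → R) (Q : Ω → R →ₗ[k] R) (w : Word X Ω) :
    FreeMonoid.lift (evalLetter f Q) w = evalWord f Q w.toList := by
  induction w using FreeMonoid.inductionOn' with
  | one => simp [evalWord]
  | of_mul a w ih => simp [evalWord, ih]

/-- The algebra homomorphism `k𝔐(X, Ω) → R` with `x ↦ f x` and `⌊·⌋_ω ↦ Q ω`. -/
noncomputable def evalHom (f : X → R) (Q : Ω → R →ₗ[k] R) : MonoidAlgebra k (Word X Ω) →ₐ[k] R :=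
  MonoidAlgebra.lift k R (Word X Ω) (FreeMonoid.lift (evalLetter f Q))

theorem evalHom_monomial (f : X → R) (Q : Ω → R →ₗ[k] R) (w : Word X Ω) :
    evalHom f Q (monomial k w) = evalWord f Q w.toList := by
  rw [← lift_evalLetter]
  exact MonoidAlgebra.lift_of _ _

theorem evalHom_bracketOp (f : X → R) (Q : Ω → R →ₗ[k] R) (ω : Ω)
    (a : MonoidAlgebra k (Word X Ω)) :
    evalHom f Q (bracketOp k X ω a) = Q ω (evalHom f Q a) := by
  induction a using monomial_induction with
  | mon w =>
    rw [bracketOp_monomial, evalHom_monomial, evalHom_monomial]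
    simp [bracket, evalWord, evalLetter]
  | add a b ha hb => simp only [map_add, ha, hb]
  | smul c a ha => simp only [map_smul, ha]

/-- The kernel of the evaluation is a two-sided ideal, stable under the operators, and it contains
`S` because `Q` satisfies the matching Rota-Baxter equation. So it is one of the ideals in the
intersection that defines `Id(S)`. -/
theorem evalHom_eq_zero {lam : Ω → k} (f : X → R) {Q : Ω → R →ₗ[k] R} (hQ : IsMatchingRB lam Q)
    {a : MonoidAlgebra k (Word X Ω)}
    (ha : a ∈ operatedIdeal (bracketOp k X (Ω := Ω)) (relations X lam)) : evalHom f Q a = 0 := by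
  rw [operatedIdeal, TwoSidedIdeal.mem_sInf] at ha
  have := @ha (TwoSidedIdeal.ker (evalHom f Q)) ⟨?_, ?_⟩
  · exact (TwoSidedIdeal.mem_ker _).1 this
  · rintro _ ⟨x, y, α, β, rfl⟩
    refine (TwoSidedIdeal.mem_ker _).2 ?_
    simp only [map_sub, map_smul, ← bracketOp_monomial, monomial_mul, map_mul, evalHom_bracketOp]
    rw [hQ α β]
    abel
  · intro ω a ha
    rw [TwoSidedIdeal.mem_ker] at ha ⊢
    rw [evalHom_bracketOp, ha, map_zero]

end Evaluation

-- The quotient: universal property, basis and multiplication table.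

section Quotient

variable {k X Ω : Type*} [CommRing k]

theorem FreeMRB.mk_surjective (lam : Ω → k) :
    Function.Surjective (FreeMRB.mk (X := X) lam) :=
  RingCon.mk'_surjective _

theorem FreeMRB.mk_smul (lam : Ω → k) (c : k) (a : MonoidAlgebra k (Word X Ω)) :
    FreeMRB.mk lam (c • a) = c • FreeMRB.mk lam a := rfl

theorem FreeMRB.mk_bracketOp (lam : Ω → k) (ω : Ω) (a : MonoidAlgebra k (Word X Ω)) :
    FreeMRB.mk lam (bracketOp k X ω a) = FreeMRB.op X lam ω (FreeMRB.mk lam a) := rfl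

theorem FreeMRB.mk_eq_zero (lam : Ω → k) {a : MonoidAlgebra k (Word X Ω)}
    (ha : a ∈ operatedIdeal (bracketOp k X (Ω := Ω)) (relations X lam)) : FreeMRB.mk lam a = 0 :=
  (RingCon.eq _).2 ((TwoSidedIdeal.rel_iff _ a 0).2 (by simpa using ha))

theorem subset_operatedIdeal {A : Type*} [Ring A] [Algebra k A] (P : Ω → A →ₗ[k] A) (S : Set A) :
    S ⊆ operatedIdeal P S := by
  intro a ha
  rw [operatedIdeal, SetLike.mem_coe, TwoSidedIdeal.mem_sInf]
  exact fun I hI => hI.1 ha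

/-- The relations in `S` involve words only; bilinearity carries the equation to all elements. -/
theorem FreeMRB.isMatchingRB (lam : Ω → k) : IsMatchingRB lam (FreeMRB.op X lam) := by
  intro α β a b
  obtain ⟨a, rfl⟩ := FreeMRB.mk_surjective lam a
  obtain ⟨b, rfl⟩ := FreeMRB.mk_surjective lam b
  simp only [← FreeMRB.mk_bracketOp, ← map_mul, ← map_add, ← FreeMRB.mk_smul]
  induction a using monomial_induction with
  | add f f' hf hf' =>
    simp only [map_add, add_mul, FreeMRB.mk_smul] at hf hf' ⊢
    rw [hf, hf']
    module
  | smul c f hf =>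
    simp only [map_add, map_smul, smul_mul_assoc, FreeMRB.mk_smul] at hf ⊢
    rw [hf]
    module
  | mon u =>
    induction b using monomial_induction with
    | add f f' hf hf' =>
      simp only [map_add, mul_add, FreeMRB.mk_smul] at hf hf' ⊢
      rw [hf, hf']
      module
    | smul c f hf =>
      simp only [map_add, map_smul, mul_smul_comm, FreeMRB.mk_smul] at hf ⊢
      rw [hf]
      module
    | mon v =>
      rw [← sub_eq_zero, ← map_sub]
      refine FreeMRB.mk_eq_zero lam (subset_operatedIdeal _ _
        ⟨FreeMonoid.ofList u, FreeMonoid.ofList v, α, β, ?_⟩)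
      simp only [monomial_mul, ← bracketOp_monomial]
      abel

/-- The homomorphism from `k𝔐(X, Ω) / Id(S)` to a matching Rota-Baxter algebra given by the images
of the elements of `X`. -/
noncomputable def FreeMRB.lift {R : Type*} [Ring R] [Algebra k R] {lam : Ω → k}
    {Q : Ω → R →ₗ[k] R} (hQ : IsMatchingRB lam Q) (f : X → R) : FreeMRB X lam →ₐ[k] R where
  toFun := Quotient.lift (evalHom f Q) (fun a b h => by
    have h' := (TwoSidedIdeal.rel_iff _ a b).1 h
    rw [← sub_eq_zero, ← map_sub]
    exact evalHom_eq_zero f hQ h')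
  map_one' := map_one (evalHom f Q)
  map_zero' := map_zero (evalHom f Q)
  map_mul' := by
    rintro ⟨a⟩ ⟨b⟩
    exact map_mul (evalHom f Q) a b
  map_add' := by
    rintro ⟨a⟩ ⟨b⟩
    exact map_add (evalHom f Q) a b
  commutes' := AlgHom.commutes (evalHom f Q)

theorem FreeMRB.lift_mk {R : Type*} [Ring R] [Algebra k R] {lam : Ω → k}
    {Q : Ω → R →ₗ[k] R} (hQ : IsMatchingRB lam Q) (f : X → R) (a : MonoidAlgebra k (Word X Ω)) :
    FreeMRB.lift hQ f (FreeMRB.mk lam a) = evalHom f Q a := rfl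

theorem FreeMRB.lift_op {R : Type*} [Ring R] [Algebra k R] {lam : Ω → k}
    {Q : Ω → R →ₗ[k] R} (hQ : IsMatchingRB lam Q) (f : X → R) (ω : Ω) (a : FreeMRB X lam) :
    FreeMRB.lift hQ f (FreeMRB.op X lam ω a) = Q ω (FreeMRB.lift hQ f a) := by
  obtain ⟨a, rfl⟩ := FreeMRB.mk_surjective lam a
  rw [← FreeMRB.mk_bracketOp, FreeMRB.lift_mk, FreeMRB.lift_mk, evalHom_bracketOp]

/-- A property of elements of the quotient that holds for `1` and is preserved under left
multiplication by the elements of `X` and by brackets of elements with the property holds for all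
words. -/
theorem FreeMRB.mk_monomial_induction {lam : Ω → k} {p : FreeMRB X lam → Prop} (one : p 1)
    (var : ∀ (x : X) (a), p a → p (FreeMRB.mk lam (monomial k (varWord x)) * a))
    (br : ∀ (ω : Ω) (a b), p a → p b → p (FreeMRB.op X lam ω a * b))
    (w : Word X Ω) : p (FreeMRB.mk lam (monomial k w)) := by
  induction hn : wordDeg w.toList using Nat.strong_induction_on generalizing w with
  | _ n ih =>
    subst hn
    induction w using FreeMonoid.casesOn with
    | one => rwa [monomial_one, map_one]
    | of_mul a w =>
      have hlt : wordDeg w.toList < wordDeg (FreeMonoid.of a * w).toList := by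
        have := a.deg_pos
        simp only [FreeMonoid.toList_of_mul, wordDeg]
        omega
      have hw := ih _ hlt w rfl
      rw [monomial_mul, map_mul]
      cases a with
      | var x => exact var x _ hw
      | br ω v =>
        have hv := ih (wordDeg v) (by simp [wordDeg, Letter.deg]; omega) (FreeMonoid.ofList v) rfl
        have := br ω _ _ hv hw
        rwa [← FreeMRB.mk_bracketOp, bracketOp_monomial] at this

theorem FreeMRB.hom_ext {R : Type*} [Ring R] [Algebra k R] {lam : Ω → k} {Q : Ω → R →ₗ[k] R}
    {φ ψ : FreeMRB X lam →ₐ[k] R} (hφ : ∀ ω a, φ (FreeMRB.op X lam ω a) = Q ω (φ a))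
    (hψ : ∀ ω a, ψ (FreeMRB.op X lam ω a) = Q ω (ψ a))
    (h : ∀ x, φ (FreeMRB.mk lam (monomial k (varWord x))) =
      ψ (FreeMRB.mk lam (monomial k (varWord x)))) : φ = ψ := by
  refine AlgHom.ext fun a => ?_
  obtain ⟨a, rfl⟩ := FreeMRB.mk_surjective lam a
  induction a using monomial_induction with
  | add a b ha hb => rw [map_add, map_add, map_add, ha, hb]
  | smul c a ha => rw [FreeMRB.mk_smul, map_smul, map_smul, ha]
  | mon w =>
    refine FreeMRB.mk_monomial_induction (p := fun a => φ a = ψ a) ?_ ?_ ?_ (FreeMonoid.ofList w)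
    · rw [map_one, map_one]
    · intro x a ha
      rw [map_mul, map_mul, h, ha]
    · intro ω a b ha hb
      rw [map_mul, map_mul, hφ, hψ, ha, hb]

theorem FreeMRB.existsUnique_hom {R : Type*} [Ring R] [Algebra k R] {lam : Ω → k}
    {Q : Ω → R →ₗ[k] R} (hQ : IsMatchingRB lam Q) (f : X → R) :
    ∃! φ : FreeMRB X lam →ₐ[k] R, (∀ ω a, φ (FreeMRB.op X lam ω a) = Q ω (φ a)) ∧
      ∀ x, φ (FreeMRB.mk lam (monomial k (varWord x))) = f x := by
  have hx : ∀ x, FreeMRB.lift hQ f (FreeMRB.mk lam (monomial k (varWord x))) = f x := by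
    intro x
    rw [FreeMRB.lift_mk, evalHom_monomial]
    simp [varWord, evalWord, evalLetter]
  refine ⟨FreeMRB.lift hQ f, ⟨FreeMRB.lift_op hQ f, hx⟩, ?_⟩
  rintro ψ ⟨h1, h2⟩
  exact FreeMRB.hom_ext h1 (FreeMRB.lift_op hQ f) fun x => by rw [h2, hx]

/-! ### The basis of matching Rota-Baxter words -/

/-- Each step of the recursion for `⋄` is one use of the matching Rota-Baxter equation, which holds
in the quotient. -/
theorem FreeMRB.mk_diamond (lam : Ω → k) (u v : List (Letter X Ω)) :
    FreeMRB.mk lam (diamond lam u v) = FreeMRB.mk lam (monomial k (FreeMonoid.ofList u)) *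
      FreeMRB.mk lam (monomial k (FreeMonoid.ofList v)) := by
  induction hn : wordDeg u + wordDeg v using Nat.strong_induction_on generalizing u v with
  | _ n ih =>
    subst hn
    rcases meet_cases u v with ⟨l, α, a, β, b, r, rfl, rfl⟩ | h
    · have h1 := ih _ (by simp [wordDeg_append, wordDeg, Letter.deg]; omega) a [.br β b] rfl
      have h2 := ih _ (by simp [wordDeg_append, wordDeg, Letter.deg]; omega) [.br α a] b rfl
      have h3 := ih _ (by simp [wordDeg_append, wordDeg, Letter.deg]; omega) a b rfl
      have hbr : ∀ (ω : Ω) (t : List (Letter X Ω)), monomial k (FreeMonoid.ofList [.br ω t]) =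
          bracketOp k X ω (monomial k (FreeMonoid.ofList t)) := fun ω t =>
        (bracketOp_monomial ω _).symm
      have hr : FreeMonoid.ofList (.br β b :: r) =
        FreeMonoid.ofList [.br β b] * FreeMonoid.ofList r := rfl
      rw [diamond_append_br_cons_br, FreeMonoid.ofList_append, monomial_mul, hr, monomial_mul]
      simp only [map_mul, map_add, FreeMRB.mk_smul, FreeMRB.mk_bracketOp, h1, h2, h3, hbr]
      -- The three terms are folded back into `P_α(a) P_β(b)`.
      rw [← FreeMRB.isMatchingRB lam α β]
      simp only [mul_assoc]
    · rw [diamond_eq_append lam h, FreeMonoid.ofList_append, monomial_mul, map_mul]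

/-- The linear span of the matching Rota-Baxter words in `k𝔐(X, Ω)`. -/
noncomputable def mrbSpan (k X Ω : Type*) [CommRing k] :
    Submodule k (MonoidAlgebra k (Word X Ω)) :=
  MonoidAlgebra.supported k k (mrbWords X Ω)

theorem monomial_mem_mrbSpan {w : Word X Ω} (h : w ∈ mrbWords X Ω) :
    monomial k w ∈ mrbSpan k X Ω := by
  rw [mrbSpan, MonoidAlgebra.supported_eq_span_single]
  exact Submodule.subset_span ⟨w, h, rfl⟩

theorem mrbSpan_induction {p : MonoidAlgebra k (Word X Ω) → Prop}
    (mon : ∀ w ∈ mrbWords X Ω, p (monomial k w)) (zero : p 0)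
    (add : ∀ f g, p f → p g → p (f + g)) (smul : ∀ (c : k) (f), p f → p (c • f))
    {f : MonoidAlgebra k (Word X Ω)} (hf : f ∈ mrbSpan k X Ω) : p f := by
  rw [mrbSpan, MonoidAlgebra.supported_eq_span_single] at hf
  induction hf using Submodule.span_induction with
  | mem x hx =>
    obtain ⟨w, hw, rfl⟩ := hx
    exact mon w hw
  | zero => exact zero
  | add x y _ _ hx hy => exact add x y hx hy
  | smul c x _ hx => exact smul c x hx

theorem bracket_mem_mrbWords {ω : Ω} {w : Word X Ω} (h : w ∈ mrbWords X Ω) :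
    bracket ω w ∈ mrbWords X Ω :=
  mem_mrbWords_iff.2 (wordGood_singleton.2 (Letter.good_br_iff.2 (mem_mrbWords_iff.1 h)))

/-- In a good word `l⌊a⌋_α` the part `l` cannot end in a bracket, and in `⌊b⌋_β r` the part `r`
cannot begin with one. A single bracket may therefore stand between `l` and `r`. -/
theorem mul_bracketOp_mul_mem_mrbSpan {l r : List (Letter X Ω)} {α β : Ω} {a b : List (Letter X Ω)}
    (hl : WordGood (l ++ [.br α a])) (hr : WordGood (.br β b :: r)) (ω : Ω)
    {f : MonoidAlgebra k (Word X Ω)} (hf : f ∈ mrbSpan k X Ω) :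
    monomial k (FreeMonoid.ofList l) * bracketOp k X ω f * monomial k (FreeMonoid.ofList r) ∈
      mrbSpan k X Ω := by
  refine mrbSpan_induction (p := fun f => monomial k (FreeMonoid.ofList l) * bracketOp k X ω f *
    monomial k (FreeMonoid.ofList r) ∈ mrbSpan k X Ω) ?_ ?_ ?_ ?_ hf
  · intro w hw
    rw [bracketOp_monomial, ← monomial_mul, ← monomial_mul]
    refine monomial_mem_mrbSpan (mem_mrbWords_iff.2 ?_)
    have hb := mem_mrbWords_iff.1 (bracket_mem_mrbWords (ω := ω) hw)
    obtain ⟨hl1, -, hl2⟩ := wordGood_append.1 hl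
    obtain ⟨-, hr1, hr2⟩ := wordGood_cons.1 hr
    have hlb := wordGood_append_of_getLast hl1 hb fun x hx hxb =>
      hl2 x hx (.br α a) (by simp) ⟨hxb, trivial⟩
    exact wordGood_append_of_head hlb hr1 fun x hx hxb =>
      hr2 (.br β b) (by simp) x hx ⟨trivial, hxb⟩
  · simp
  · intro f g hf hg
    rw [map_add, mul_add, add_mul]
    exact add_mem hf hg
  · intro c f hf
    rw [map_smul, mul_smul_comm, smul_mul_assoc]
    exact Submodule.smul_mem _ c hf

theorem diamond_mem_mrbSpan (lam : Ω → k) {u v : List (Letter X Ω)} (hu : WordGood u)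
    (hv : WordGood v) : diamond lam u v ∈ mrbSpan k X Ω := by
  induction hn : wordDeg u + wordDeg v using Nat.strong_induction_on generalizing u v with
  | _ n ih =>
    subst hn
    rcases meet_cases u v with ⟨l, α, a, β, b, r, rfl, rfl⟩ | h
    · have hα := (wordGood_append.1 hu).2.1
      have hβ := (wordGood_cons.1 hv).1
      have ha := Letter.good_br_iff.1 (wordGood_singleton.1 hα)
      have hb := Letter.good_br_iff.1 (wordGood_singleton.1 hβ)
      rw [diamond_append_br_cons_br, mul_add, mul_add, add_mul, add_mul, mul_smul_comm,
        smul_mul_assoc]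
      refine add_mem (add_mem ?_ ?_) (Submodule.smul_mem _ _ ?_)
      · refine mul_bracketOp_mul_mem_mrbSpan hu hv α (ih _ ?_ ha hβ rfl)
        simp [wordDeg_append, wordDeg, Letter.deg]
        omega
      · refine mul_bracketOp_mul_mem_mrbSpan hu hv β (ih _ ?_ hα hb rfl)
        simp [wordDeg_append, wordDeg, Letter.deg]
        omega
      · refine mul_bracketOp_mul_mem_mrbSpan hu hv α (ih _ ?_ ha hb rfl)
        simp [wordDeg_append, wordDeg, Letter.deg]
        omega
    · rw [diamond_eq_append lam h]
      exact monomial_mem_mrbSpan (mem_mrbWords_iff.2 (wordGood_append.2 ⟨hu, hv, h⟩))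

-- Spanning.

/-- The quotient map `k𝔐(X, Ω) → k𝔐(X, Ω) / Id(S)` as a linear map. -/
noncomputable def FreeMRB.mkLinear (lam : Ω → k) :
    MonoidAlgebra k (Word X Ω) →ₗ[k] FreeMRB X lam where
  toFun := FreeMRB.mk lam
  map_add' := map_add _
  map_smul' := FreeMRB.mk_smul lam

/-- The image of the span of the matching Rota-Baxter words in the quotient. -/
noncomputable def mrbImage (X : Type*) (lam : Ω → k) : Submodule k (FreeMRB X lam) :=
  (mrbSpan k X Ω).map (FreeMRB.mkLinear lam)

theorem mk_mem_mrbImage (lam : Ω → k) {f : MonoidAlgebra k (Word X Ω)} (hf : f ∈ mrbSpan k X Ω) :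
    FreeMRB.mk lam f ∈ mrbImage X lam := ⟨f, hf, rfl⟩

theorem op_mem_mrbImage {lam : Ω → k} (ω : Ω) {a : FreeMRB X lam} (ha : a ∈ mrbImage X lam) :
    FreeMRB.op X lam ω a ∈ mrbImage X lam := by
  obtain ⟨f, hf, rfl⟩ := ha
  refine mrbSpan_induction (p := fun f => FreeMRB.op X lam ω (FreeMRB.mkLinear lam f) ∈
    mrbImage X lam) ?_ ?_ ?_ ?_ hf
  · intro w hw
    have := mk_mem_mrbImage lam (monomial_mem_mrbSpan (k := k) (bracket_mem_mrbWords (ω := ω) hw))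
    rwa [← bracketOp_monomial, FreeMRB.mk_bracketOp] at this
  · simp
  · intro f g hf hg
    rw [map_add, map_add]
    exact add_mem hf hg
  · intro c f hf
    rw [map_smul, map_smul]
    exact Submodule.smul_mem _ c hf

theorem mul_mem_mrbImage {lam : Ω → k} {a b : FreeMRB X lam} (ha : a ∈ mrbImage X lam)
    (hb : b ∈ mrbImage X lam) : a * b ∈ mrbImage X lam := by
  obtain ⟨f, hf, rfl⟩ := ha
  obtain ⟨g, hg, rfl⟩ := hb
  refine mrbSpan_induction (p := fun f => FreeMRB.mkLinear lam f * FreeMRB.mkLinear lam g ∈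
    mrbImage X lam) ?_ ?_ ?_ ?_ hf
  · intro u hu
    refine mrbSpan_induction (p := fun g => FreeMRB.mkLinear lam (monomial k u) *
      FreeMRB.mkLinear lam g ∈ mrbImage X lam) ?_ ?_ ?_ ?_ hg
    · intro v hv
      have := mk_mem_mrbImage lam
        (diamond_mem_mrbSpan lam (mem_mrbWords_iff.1 hu) (mem_mrbWords_iff.1 hv))
      rwa [FreeMRB.mk_diamond] at this
    · simp
    · intro f g hf hg
      rw [map_add, mul_add]
      exact add_mem hf hg
    · intro c f hf
      rw [map_smul, mul_smul_comm]
      exact Submodule.smul_mem _ c hf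
  · simp
  · intro f g hf hg
    rw [map_add, add_mul]
    exact add_mem hf hg
  · intro c f hf
    rw [map_smul, smul_mul_assoc]
    exact Submodule.smul_mem _ c hf

/-- The image contains `1` and `X` and is closed under products and operators, so it contains every
word. No rewriting of words to normal form is needed. -/
theorem mem_mrbImage (lam : Ω → k) (a : FreeMRB X lam) : a ∈ mrbImage X lam := by
  obtain ⟨a, rfl⟩ := FreeMRB.mk_surjective lam a
  induction a using monomial_induction with
  | add a b ha hb => rw [map_add]; exact add_mem ha hb
  | smul c a ha => rw [FreeMRB.mk_smul]; exact Submodule.smul_mem _ c ha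
  | mon w =>
    refine FreeMRB.mk_monomial_induction (p := fun a => a ∈ mrbImage X lam) ?_ ?_ ?_
      (FreeMonoid.ofList w)
    · have : FreeMRB.mk lam (monomial k 1) ∈ mrbImage X lam :=
        mk_mem_mrbImage lam (monomial_mem_mrbSpan (mem_mrbWords_iff.2 wordGood_nil))
      rwa [monomial_one, map_one] at this
    · intro x a ha
      exact mul_mem_mrbImage (mk_mem_mrbImage lam (monomial_mem_mrbSpan (mem_mrbWords_iff.2
        (wordGood_singleton.2 (.var x))))) ha
    · intro ω a b ha hb
      exact mul_mem_mrbImage (op_mem_mrbImage ω ha) hb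

-- Linear independence.

/-- The homomorphism from the quotient to `k𝔐(X, Ω)` with the product `⋄`. -/
noncomputable def FreeMRB.toDiamond (X : Type*) (lam : Ω → k) :
    FreeMRB X lam →ₐ[k] DiamondAlgebra X lam :=
  FreeMRB.lift (DiamondAlgebra.isMatchingRB lam) fun x =>
    DiamondAlgebra.of lam (monomial k (varWord x))

/-- Evaluation rebuilds the word letter by letter with `⋄`. In a good word two brackets never meet,
so each of these products is concatenation. -/
theorem evalWord_diamond_of_wordGood (lam : Ω → k) (w : List (Letter X Ω)) (hw : WordGood w) :
    evalWord (fun x => DiamondAlgebra.of lam (monomial k (varWord x))) (DiamondAlgebra.op lam) w =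
      DiamondAlgebra.of lam (monomial k (FreeMonoid.ofList w)) := by
  induction hn : wordDeg w using Nat.strong_induction_on generalizing w with
  | _ n ih =>
    subst hn
    cases w with
    | nil => rw [evalWord, FreeMonoid.ofList_nil, monomial_one]; rfl
    | cons a w =>
      have hpos := a.deg_pos
      obtain ⟨h1, h2, h3⟩ := wordGood_cons.1 hw
      rw [evalWord, ih _ (by simp only [wordDeg]; omega) w h2 rfl]
      have ha : evalLetter (fun x => DiamondAlgebra.of lam (monomial k (varWord x)))
          (DiamondAlgebra.op lam) a =
            DiamondAlgebra.of lam (monomial k (FreeMonoid.ofList [a])) := by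
        cases a with
        | var x => rw [evalLetter]; rfl
        | br ω v =>
          rw [evalLetter, ih (wordDeg v) (by simp only [wordDeg, Letter.deg]; omega) v
            (Letter.good_br_iff.1 (wordGood_singleton.1 h1)) rfl, DiamondAlgebra.op_of,
            bracketOp_monomial]
          rfl
      rw [ha, DiamondAlgebra.of_mul_of, diamondMul_monomial]
      exact congrArg _ (diamond_eq_append lam h3)

theorem FreeMRB.toDiamond_mk (lam : Ω → k) {w : Word X Ω} (hw : w ∈ mrbWords X Ω) :
    FreeMRB.toDiamond X lam (FreeMRB.mk lam (monomial k w)) =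
      DiamondAlgebra.of lam (monomial k w) := by
  rw [FreeMRB.toDiamond, FreeMRB.lift_mk, evalHom_monomial]
  exact evalWord_diamond_of_wordGood lam w.toList (mem_mrbWords_iff.1 hw)

/-- The linear map to the model carries the family to distinct elements of the monomial basis of
`k𝔐`. -/
theorem FreeMRB.linearIndependent (lam : Ω → k) :
    LinearIndependent k fun w : mrbWords X Ω => FreeMRB.mk lam (monomial k w.1) := by
  refine LinearIndependent.of_comp
    ((DiamondAlgebra.of lam).symm.toLinearMap ∘ₗ (FreeMRB.toDiamond X lam).toLinearMap) ?_
  have h : (((DiamondAlgebra.of lam).symm.toLinearMap ∘ₗ (FreeMRB.toDiamond X lam).toLinearMap) ∘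
      fun w : mrbWords X Ω => FreeMRB.mk lam (monomial k w.1)) =
      MonoidAlgebra.basis (Word X Ω) k ∘ Subtype.val := by
    funext w
    simp only [Function.comp_apply, LinearMap.comp_apply, AlgHom.toLinearMap_apply,
      FreeMRB.toDiamond_mk lam w.2, LinearEquiv.coe_coe, LinearEquiv.symm_apply_apply]
    exact (MonoidAlgebra.basis_apply k w.1).symm
  rw [h]
  exact (MonoidAlgebra.basis (Word X Ω) k).linearIndependent.comp _ Subtype.val_injective

theorem FreeMRB.top_le_span (lam : Ω → k) :
    ⊤ ≤ Submodule.span k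
      (Set.range fun w : mrbWords X Ω => FreeMRB.mk lam (monomial k w.1)) := by
  rintro a -
  obtain ⟨f, hf, rfl⟩ := mem_mrbImage lam a
  refine mrbSpan_induction (p := fun f => FreeMRB.mkLinear lam f ∈ Submodule.span k
      (Set.range fun w : mrbWords X Ω => FreeMRB.mk lam (monomial k w.1))) ?_ ?_ ?_ ?_ hf
  · exact fun w hw => Submodule.subset_span ⟨⟨w, hw⟩, rfl⟩
  · simp
  · intro f g hf hg
    rw [map_add]
    exact add_mem hf hg
  · intro c f hf
    rw [map_smul]
    exact Submodule.smul_mem _ c hf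

/-- The basis of the quotient formed by the matching Rota-Baxter words. -/
noncomputable def FreeMRB.basis (X : Type*) (lam : Ω → k) :
    Module.Basis (mrbWords X Ω) k (FreeMRB X lam) :=
  Module.Basis.mk (FreeMRB.linearIndependent lam) (FreeMRB.top_le_span lam)

theorem FreeMRB.basis_apply (lam : Ω → k) (w : mrbWords X Ω) :
    FreeMRB.basis X lam w = FreeMRB.mk lam (monomial k w.1) :=
  Module.Basis.mk_apply _ _ w

/-- This turns `FreeMRB.mk_diamond` into a formula for the structure constants: the coordinates of a
product are the coefficients of `⋄`. -/
theorem FreeMRB.basis_repr_mk (lam : Ω → k) {f : MonoidAlgebra k (Word X Ω)}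
    (hf : f ∈ mrbSpan k X Ω) (v : mrbWords X Ω) :
    (FreeMRB.basis X lam).repr (FreeMRB.mk lam f) v = f.coeff v.1 := by
  classical
  refine mrbSpan_induction (p := fun f =>
    (FreeMRB.basis X lam).repr (FreeMRB.mk lam f) v = f.coeff v.1) ?_ ?_ ?_ ?_ hf
  · intro w hw
    rw [← FreeMRB.basis_apply lam ⟨w, hw⟩, Module.Basis.repr_self, monomial_eq_single,
      MonoidAlgebra.coeff_single, Finsupp.single_apply, Finsupp.single_apply]
    simp [Subtype.ext_iff]
  · simp
  · intro f g hf hg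
    simp [hf, hg]
  · intro c f hf
    simp [FreeMRB.mk_smul, hf]

end Quotient

end MatchingRB

theorem mainTheorem6 {k X Ω : Type*} [CommRing k] [Nontrivial k] [Nonempty Ω] (lam : Ω → k) :
    -- `𝔛_∞ = Irr(S)` for all choices of well orders on `X` and `Ω`
    (∀ (rX : X → X → Prop) (rΩ : Ω → Ω → Prop), IsWellOrder X rX → IsWellOrder Ω rΩ →
      MatchingRB.Irr rX rΩ (MatchingRB.relations X lam) = MatchingRB.mrbWords X Ω) ∧
    -- `𝔛_∞` consists of the words without adjacent bracketed factors
    MatchingRB.mrbWords X Ω =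
      {w | ∀ (q : MatchingRB.StarWord X Ω) (u v : MatchingRB.Word X Ω) (α β : Ω),
        w ≠ q.subst (MatchingRB.bracket α u * MatchingRB.bracket β v)} ∧
    -- the quotient is a free matching Rota-Baxter algebra of weight `lam` on `X`
    MatchingRB.IsMatchingRB lam (MatchingRB.FreeMRB.op X lam) ∧
    (∀ (R : Type*) [Ring R] [Algebra k R] (Q : Ω → R →ₗ[k] R),
      MatchingRB.IsMatchingRB lam Q → ∀ f : X → R,
        ∃! φ : MatchingRB.FreeMRB X lam →ₐ[k] R,
          (∀ ω a, φ (MatchingRB.FreeMRB.op X lam ω a) = Q ω (φ a)) ∧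
          ∀ x, φ (MatchingRB.FreeMRB.mk lam
            (MatchingRB.monomial k (MatchingRB.varWord x))) = f x) ∧
    -- `𝔛_∞` modulo `Id(S)` is a linear basis
    ∃ b : Module.Basis (MatchingRB.mrbWords X Ω) k (MatchingRB.FreeMRB X lam),
      (∀ w, b w = MatchingRB.FreeMRB.mk lam (MatchingRB.monomial k w.1)) ∧
      -- the operators in terms of this basis
      (∀ ω w, ∃ h : MatchingRB.bracket ω w.1 ∈ MatchingRB.mrbWords X Ω,
        MatchingRB.FreeMRB.op X lam ω (b w) = b ⟨MatchingRB.bracket ω w.1, h⟩) ∧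
      -- the product in terms of this basis
      ∀ w w' : MatchingRB.mrbWords X Ω,
        (∀ v ∉ MatchingRB.mrbWords X Ω,
          (MatchingRB.diamond lam w.1.toList w'.1.toList).coeff v = 0) ∧
        ∀ v : MatchingRB.mrbWords X Ω, b.repr (b w * b w') v =
          (MatchingRB.diamond lam w.1.toList w'.1.toList).coeff v.1 := by
  refine ⟨fun rX rΩ _ _ => MatchingRB.irr_relations_eq_mrbWords rX rΩ lam, MatchingRB.mrbWords_eq,
    MatchingRB.FreeMRB.isMatchingRB lam,
    fun R _ _ Q hQ f => MatchingRB.FreeMRB.existsUnique_hom hQ f,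
    MatchingRB.FreeMRB.basis X lam, MatchingRB.FreeMRB.basis_apply lam, fun ω w => ?_,
    fun w w' => ?_⟩
  · refine ⟨MatchingRB.bracket_mem_mrbWords w.2, ?_⟩
    rw [MatchingRB.FreeMRB.basis_apply, MatchingRB.FreeMRB.basis_apply,
      ← MatchingRB.FreeMRB.mk_bracketOp, MatchingRB.bracketOp_monomial]
  · have hmem := MatchingRB.diamond_mem_mrbSpan lam
      (MatchingRB.mem_mrbWords_iff.1 w.2) (MatchingRB.mem_mrbWords_iff.1 w'.2)
    refine ⟨fun v hv => (MonoidAlgebra.mem_supported').1 hmem v hv, fun v => ?_⟩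
    rw [← MatchingRB.FreeMRB.basis_repr_mk lam hmem, MatchingRB.FreeMRB.mk_diamond,
      MatchingRB.FreeMRB.basis_apply, MatchingRB.FreeMRB.basis_apply]
    rfl
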